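/- Let $E$ be a complex Banach space, let $L(E)$ be the Banach space of bounded linear operators on $E$ with the operator norm, and let $a\ge 0$. For $n\in\mathbb N$, $n\ge 1$, put $I_n=(-1/n,1/n)$ and let $\tilde{\mathcal O}^{-1/n}$ be the space of holomorphic functions $F$ on $\mathbb R+iI_n$ such that for every compact $K\subset I_n$ and every $\varepsilon>0$ the seminorm $\sup_{z\in\mathbb R+iK}|F(z)|e^{(1/n-\varepsilon)|\mathrm{Re}\, z|}$ is finite; topologize it by these seminorms. Let $\mathcal P_*(\mathbb D)=\operatorname{ind\,lim}_{n\to\infty}\tilde{\mathcal O}^{-1/n}$ (locally convex inductive limit), its elements being viewed as functions on $\mathbb R$. Let $\mathcal P_{*,a}(\mathbb D)=\{\varphi\in C^\infty(\mathbb R): e^{a\cdot}\varphi\in\mathcal P_*(\mathbb D)\}$ with the topology transported by $\varphi\mapsto e^{a\cdot}\varphi$, and let $\mathcal Q_a(\mathbb D,L(E))$ be the space of continuous linear mappings from $\mathcal P_{*,a}(\mathbb D)$ into $L(E)$. A local operator is a series $P(d/dt)=\sum_{k=0}^\infty b_k(d/dt)^k$ with $b_k\in\mathbb C$ and $\lim_{k\to\infty}(|b_k|k!)^{1/k}=0$.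 **Proposition.** For every $G\in\mathcal Q_a(\mathbb D,L(E))$ there exist a local operator $P(d/dt)=\sum_k b_k(d/dt)^k$ and a continuous function $g:\mathbb R\to L(E)$ such that for every $\varepsilon>0$ there is $C_\varepsilon>0$ with $$e^{-ax}\|g(x)\|\le C_\varepsilon e^{\varepsilon|x|},\qquad x\in\mathbb R,$$ and such that $G=P(d/dt)g$, that is, for every $\varphi\in\mathcal P_{*,a}(\mathbb D)$ all the functions $\varphi^{(k)}g$ are integrable on $\mathbb R$ and $$G(\varphi)=\sum_{k=0}^\infty b_k(-1)^k\int_{\mathbb R}\varphi^{(k)}(t)\,g(t)\,dt,$$ where the series converges unconditionally in $L(E)$. -/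

import Mathlib

open Filter Topology MeasureTheory
open scoped ContDiff

noncomputable section

namespace FourierHyper

/-- The open interval `I_ν = (-1/ν, 1/ν)`. -/
def I (ν : ℝ) : Set ℝ := Set.Ioo (-(1 / ν)) (1 / ν)

/-- The strip `ℝ + i I_ν`. -/
def strip (ν : ℝ) : Set ℂ := {z | z.im ∈ I ν}

/-- The space `Õ^{-δ}(𝔻 + i I_ν)`: holomorphic functions `F` on the strip `ℝ + i I_ν` such that for
every compact `K ⊆ I_ν` and `ε > 0` one has `|F z| ≤ C e^{-(δ-ε)|Re z|}` on `ℝ + i K`.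
A function on the strip is represented by its extension by zero to `ℂ`. -/
def holoDecay (δ ν : ℝ) : Submodule ℂ (ℂ → ℂ) where
  carrier := {F | DifferentiableOn ℂ F (strip ν) ∧ (∀ z, z ∉ strip ν → F z = 0) ∧
    ∀ K : Set ℝ, IsCompact K → K ⊆ I ν → ∀ ε : ℝ, 0 < ε →
      ∃ C : ℝ, ∀ z : ℂ, z.im ∈ K → ‖F z‖ ≤ C * Real.exp (-(δ - ε) * |z.re|)}
  add_mem' := by
    rintro F G ⟨hF, hF0, hFb⟩ ⟨hG, hG0, hGb⟩
    refine ⟨hF.add hG, fun z hz => by simp [hF0 z hz, hG0 z hz], fun K hK hKI ε hε => ?_⟩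
    obtain ⟨C, hC⟩ := hFb K hK hKI ε hε
    obtain ⟨D, hD⟩ := hGb K hK hKI ε hε
    refine ⟨C + D, fun z hz => ?_⟩
    have h1 := hC z hz
    have h2 := hD z hz
    have h3 := norm_add_le (F z) (G z)
    rw [add_mul]
    exact h3.trans (add_le_add h1 h2)
  zero_mem' := ⟨differentiableOn_const 0, fun _ _ => rfl, fun _ _ _ _ _ => ⟨0, by simp⟩⟩
  smul_mem' := by
    rintro c F ⟨hF, hF0, hFb⟩
    refine ⟨hF.const_smul c, fun z hz => by simp [hF0 z hz], fun K hK hKI ε hε => ?_⟩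
    obtain ⟨C, hC⟩ := hFb K hK hKI ε hε
    refine ⟨‖c‖ * C, fun z hz => ?_⟩
    have h1 := mul_le_mul_of_nonneg_left (hC z hz) (norm_nonneg c)
    simpa [mul_assoc] using h1

/-- The space `Õ^{-δ}(𝔻 + i I_ν)` as a type, to be given its Fréchet topology (and not the
topology of pointwise convergence). -/
def HoloDecay (δ ν : ℝ) : Type := ↥(holoDecay δ ν)

instance (δ ν : ℝ) : AddCommGroup (HoloDecay δ ν) := inferInstanceAs (AddCommGroup ↥(holoDecay δ ν))
instance (δ ν : ℝ) : Module ℂ (HoloDecay δ ν) := inferInstanceAs (Module ℂ ↥(holoDecay δ ν))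

/-- Indices of the defining seminorms: a compact `K ⊆ I_ν` and an `ε > 0`. -/
def SeminormIndex (ν : ℝ) : Type := {K : Set ℝ // IsCompact K ∧ K ⊆ I ν} × {ε : ℝ // 0 < ε}

instance (ν : ℝ) : Nonempty (SeminormIndex ν) :=
  ⟨(⟨∅, isCompact_empty, Set.empty_subset _⟩, ⟨1, one_pos⟩)⟩

theorem holoDecay_bddAbove {δ ν : ℝ} (i : SeminormIndex ν) (F : HoloDecay δ ν) :
    BddAbove (Set.range fun z : {z : ℂ // z.im ∈ i.1.1} =>
      ‖F.1 z.1‖ * Real.exp ((δ - i.2.1) * |z.1.re|)) := by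
  obtain ⟨C, hC⟩ := F.2.2.2 i.1.1 i.1.2.1 i.1.2.2 i.2.1 i.2.2
  refine ⟨C, ?_⟩
  rintro _ ⟨z, rfl⟩
  have h := mul_le_mul_of_nonneg_right (hC z.1 z.2)
    (Real.exp_pos ((δ - i.2.1) * |z.1.re|)).le
  rwa [mul_assoc, ← Real.exp_add, show -(δ - i.2.1) * |z.1.re| + (δ - i.2.1) * |z.1.re| = 0 by ring,
    Real.exp_zero, mul_one] at h

/-- The seminorms `sup {|F z| e^{(δ-ε)|Re z|} : z ∈ ℝ + i K}`. -/
def holoSeminorm (δ ν : ℝ) : SeminormFamily ℂ (HoloDecay δ ν) (SeminormIndex ν) := fun i =>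
  Seminorm.of
    (fun F => ⨆ z : {z : ℂ // z.im ∈ i.1.1}, ‖F.1 z.1‖ * Real.exp ((δ - i.2.1) * |z.1.re|))
    (by
      intro F G
      refine Real.iSup_le (fun z => ?_) (add_nonneg
        (Real.iSup_nonneg fun z => by positivity) (Real.iSup_nonneg fun z => by positivity))
      have h1 := le_ciSup (holoDecay_bddAbove i F) z
      have h2 := le_ciSup (holoDecay_bddAbove i G) z
      refine le_trans ?_ (add_le_add h1 h2)
      rw [← add_mul]
      exact mul_le_mul_of_nonneg_right (norm_add_le (F.1 z.1) (G.1 z.1)) (Real.exp_pos _).le)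
    (by
      intro c F
      rw [Real.mul_iSup_of_nonneg (norm_nonneg c)]
      congr 1
      funext z
      rw [← mul_assoc]
      congr 1
      exact norm_smul c (F.1 z.1))

instance (δ ν : ℝ) : TopologicalSpace (HoloDecay δ ν) :=
  (holoSeminorm δ ν).moduleFilterBasis.topology

theorem I_anti {n m : ℝ} (hn : 0 < n) (h : n ≤ m) : I m ⊆ I n := by
  have := one_div_le_one_div_of_le hn h
  exact Set.Ioo_subset_Ioo (by linarith) this

/-- Restricting the strip and weakening the decay. -/
theorem holoDecay_mono {n m : ℕ+} (h : n ≤ m) {F : ℂ → ℂ} (hF : F ∈ holoDecay (1 / (n : ℝ)) n) :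
    (strip (m : ℝ)).indicator F ∈ holoDecay (1 / (m : ℝ)) m := by
  have hn : (0 : ℝ) < n := by exact_mod_cast n.pos
  have hnm : (n : ℝ) ≤ m := by exact_mod_cast h
  have hI : I (m : ℝ) ⊆ I n := I_anti hn hnm
  obtain ⟨h1, -, h3⟩ := hF
  refine ⟨?_, fun z hz => Set.indicator_of_notMem hz _, fun K hK hKI ε hε => ?_⟩
  · exact (h1.mono fun z hz => hI hz).congr fun z hz => Set.indicator_of_mem hz _
  · obtain ⟨C, hC⟩ := h3 K hK (hKI.trans hI) ε hε
    refine ⟨C, fun z hz => ?_⟩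
    have hz' : z ∈ strip (m : ℝ) := hKI hz
    rw [Set.indicator_of_mem hz']
    have hC0 : 0 ≤ C := by
      have h0 := (norm_nonneg _).trans (hC z hz)
      exact nonneg_of_mul_nonneg_left h0 (Real.exp_pos _)
    refine (hC z hz).trans (mul_le_mul_of_nonneg_left (Real.exp_le_exp.mpr ?_) hC0)
    have := one_div_le_one_div_of_le hn hnm
    exact mul_le_mul_of_nonneg_right (by linarith) (abs_nonneg _)

/-- The rapidly decreasing real analytic functions: restrictions to `ℝ` of the elements of the
spaces `Õ^{-1/n}(𝔻 + i I_n)`, `n ≥ 1`. -/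
def rapid : Submodule ℂ (ℝ → ℂ) where
  carrier := {φ | ∃ n : ℕ+, ∃ F ∈ holoDecay (1 / (n : ℝ)) n, ∀ x : ℝ, φ x = F x}
  add_mem' := by
    rintro φ ψ ⟨n, F, hF, hφ⟩ ⟨m, G, hG, hψ⟩
    refine ⟨max n m, _, Submodule.add_mem _ (holoDecay_mono (le_max_left n m) hF)
      (holoDecay_mono (le_max_right n m) hG), fun x => ?_⟩
    have hp : (0 : ℝ) < ((max n m : ℕ+) : ℝ) := by exact_mod_cast (max n m).pos
    have hx : (x : ℂ) ∈ strip ((max n m : ℕ+) : ℝ) := by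
      simp only [strip, I, Set.mem_ofPred_eq, Complex.ofReal_im, Set.mem_Ioo]
      constructor
      · have := one_div_pos.mpr hp
        linarith
      · exact one_div_pos.mpr hp
    simp [hφ, hψ, Set.indicator_of_mem hx]
  zero_mem' := ⟨1, 0, Submodule.zero_mem _, fun _ => rfl⟩
  smul_mem' := by
    rintro c φ ⟨n, F, hF, hφ⟩
    exact ⟨n, c • F, Submodule.smul_mem _ c hF, fun x => by simp [hφ]⟩

/-- The test space `𝒫_*(𝔻)` as a type, to be given its inductive limit topology. -/
def Rapid : Type := ↥rapid

instance : AddCommGroup Rapid := inferInstanceAs (AddCommGroup ↥rapid)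
instance : Module ℂ Rapid := inferInstanceAs (Module ℂ ↥rapid)

/-- The canonical map `Õ^{-1/n}(𝔻 + i I_n) → 𝒫_*(𝔻)`, `F ↦ F|_ℝ`. -/
def toRapid (n : ℕ+) : HoloDecay (1 / (n : ℝ)) n →ₗ[ℂ] Rapid where
  toFun F := ⟨fun x : ℝ => F.1 x, n, F.1, F.2, fun _ => rfl⟩
  map_add' _ _ := rfl
  map_smul' _ _ := rfl

/-- The (locally convex) inductive limit topology of `𝒫_*(𝔻) = ind lim Õ^{-1/n}(𝔻 + i I_n)`:
the finest locally convex vector space topology for which the canonical maps are continuous. -/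
instance : TopologicalSpace Rapid :=
  sInf {t : TopologicalSpace Rapid | @IsTopologicalAddGroup Rapid t _ ∧
    @ContinuousSMul ℂ Rapid _ _ t ∧ @LocallyConvexSpace ℝ Rapid _ _ _ _ t ∧
    ∀ n : ℕ+, @Continuous _ _ _ t (toRapid n)}

/-- The functions `φ ∈ C^∞(ℝ)` with `e^{a·} φ ∈ 𝒫_*(𝔻)`. -/
def weightedRapid (a : ℝ) : Submodule ℂ (ℝ → ℂ) where
  carrier := {φ | ContDiff ℝ ∞ φ ∧ (fun x : ℝ => (Real.exp (a * x) : ℂ) * φ x) ∈ rapid}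
  add_mem' := by
    rintro φ ψ ⟨h1, h2⟩ ⟨h3, h4⟩
    refine ⟨h1.add h3, ?_⟩
    convert rapid.add_mem h2 h4 using 1
    funext x
    simp [mul_add]
  zero_mem' := by
    refine ⟨contDiff_const, ?_⟩
    convert rapid.zero_mem using 1
    funext x
    simp
  smul_mem' := by
    rintro c φ ⟨h1, h2⟩
    refine ⟨h1.const_smul c, ?_⟩
    convert rapid.smul_mem c h2 using 1
    funext x
    simp [mul_left_comm]

/-- The test space `𝒫_{*,a}(𝔻)` as a type. -/
def WeightedRapid (a : ℝ) : Type := ↥(weightedRapid a)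

instance (a : ℝ) : AddCommGroup (WeightedRapid a) := inferInstanceAs (AddCommGroup ↥(weightedRapid a))
instance (a : ℝ) : Module ℂ (WeightedRapid a) := inferInstanceAs (Module ℂ ↥(weightedRapid a))
instance (a : ℝ) : CoeFun (WeightedRapid a) (fun _ => ℝ → ℂ) := ⟨fun φ => φ.1⟩

/-- The map `φ ↦ e^{a·} φ` from `𝒫_{*,a}(𝔻)` to `𝒫_*(𝔻)`. -/
def expMul (a : ℝ) (φ : WeightedRapid a) : Rapid :=
  ⟨fun x : ℝ => (Real.exp (a * x) : ℂ) * φ x, φ.2.2⟩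

/-- The topology of `𝒫_{*,a}(𝔻)` is transported from `𝒫_*(𝔻)` along `φ ↦ e^{a·} φ`. -/
instance (a : ℝ) : TopologicalSpace (WeightedRapid a) :=
  TopologicalSpace.induced (expMul a) inferInstance

/-- `𝒬_a(𝔻, X)`: continuous linear mappings from `𝒫_{*,a}(𝔻)` into `X`. -/
abbrev Q (a : ℝ) (X : Type*) [NormedAddCommGroup X] [NormedSpace ℂ X] : Type _ :=
  WeightedRapid a →L[ℂ] X

/-- `∑ b_k (d/dt)^k` is a local operator: `(|b_k| k!)^{1/k} → 0`. -/
def IsLocalOperator (b : ℕ → ℂ) : Prop :=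
  Tendsto (fun k : ℕ => (‖b k‖ * (k.factorial : ℝ)) ^ (1 / (k : ℝ))) atTop (𝓝 0)

/-- `G = P(d/dt) g` in `𝒬_a(𝔻, X)`, where `P(d/dt) = ∑ b_k (d/dt)^k` and the function `g` and its
derivatives act on test functions by `⟨g^{(k)}, φ⟩ = (-1)^k ∫ φ^{(k)}(t) g(t) dt`
(absolutely convergent integrals):
`⟨G, φ⟩ = ∑ b_k ⟨g^{(k)}, φ⟩` for every test function `φ`, with convergence in `X`. -/
def EqLocalOperatorApply {a : ℝ} {X : Type*} [NormedAddCommGroup X] [NormedSpace ℂ X]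
    (G : Q a X) (b : ℕ → ℂ) (g : ℝ → X) : Prop :=
  ∀ φ : WeightedRapid a,
    (∀ k : ℕ, Integrable (fun t : ℝ => iteratedDeriv k φ t • g t)) ∧
    HasSum (fun k : ℕ => b k • ((-1 : ℂ) ^ k • ∫ t : ℝ, iteratedDeriv k φ t • g t)) (G φ)

end FourierHyper

end

/-! Multiplication by e^{a·} reduces the problem to a functional on 𝒫_*. Testing `G` against the
heat kernel centred at x gives a function U(t,x), t > 0 (`Q.heatExtension`). `G` is bounded on every
Banach space `boundedHolo n`, where the kernel has norm at most n e^{2/(n²t)} e^t e^{|x|/n}. Using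
all n at once, U is O(e^{ε/t}) as t → 0 and O(e^{ε|x|}) in x for every ε > 0
(`Q.exists_heatExtension_le`).

The singularity at t = 0 is removed by averaging over a random time. Let μ be the law of ∑ c_j X_j
with independent standard exponential X_j; its Laplace transform is ∏ (1 + s c_j)⁻¹. Put u(x) = ∫
U(t,x) dμ(t). Formally the Fourier transform of u is that of `G` times ∏ (1 + c_j (2πξ)²)⁻¹, so
f(d/dx) with f(ζ) = ∏ (1 - c_j ζ²) recovers `G` from u. Two opposite demands fall on the c_j: c_j =
o(j⁻²) makes f of exponential type zero, hence a local operator (`exists_entire_product`,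
`exists_taylor_coefficients`), while c_j must decay so little faster than j⁻² that μ has too little
mass near 0 for the singularity of U to spoil integrability (`exists_coefficients`,
`exists_adapted_mixture`). The result is g = e^{a·} u and P = f(d/dt - a).

The identity G = P(d/dt) g is checked on test functions. Pairing with u is the same as applying `G`
to the test function convolved with a mixture of Gaussians (`Q.integral_smul_average`), and the
transposed operator undoes that convolution, by Fourier inversion (`hasSum_integral_comp_sub`). The
resulting series converges absolutely in some `boundedHolo n`, so `G` may be applied term by term.
-/

open scoped ENNReal

noncomputable section

namespace FourierHyper

/-! ### Banach spaces of holomorphic functions on strips, and restriction of `G` to them. -/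

section

theorem isOpen_strip (ν : ℝ) : IsOpen (strip ν) :=
  isOpen_Ioo.preimage Complex.continuous_im

theorem ofReal_mem_strip (n : ℕ+) (x : ℝ) : (x : ℂ) ∈ strip (n : ℝ) := by
  have hp : (0 : ℝ) < n := by exact_mod_cast n.pos
  have := one_div_pos.mpr hp
  simp only [strip, I, Set.mem_ofPred_eq, Complex.ofReal_im, Set.mem_Ioo]
  constructor <;> linarith

/-- Holomorphic functions `F` on the strip `ℝ + i I_n` with `|F z| e^{|Re z|/n}` bounded, encoded by
the bounded function `F z * e^{|Re z|/n}`, extended by zero. -/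
def boundedHolo (n : ℕ+) : Submodule ℂ (lp (fun _ : ℂ => ℂ) ∞) where
  carrier := {f | DifferentiableOn ℂ (fun z => f z * Real.exp (-(|z.re| / n))) (strip (n : ℝ)) ∧
    ∀ z ∉ strip (n : ℝ), f z = 0}
  add_mem' := by
    rintro f g ⟨hf, hf0⟩ ⟨hg, hg0⟩
    refine ⟨?_, fun z hz => by simp [hf0 z hz, hg0 z hz]⟩
    simpa [add_mul] using hf.fun_add hg
  zero_mem' := ⟨by simp, fun _ _ => rfl⟩
  smul_mem' := by
    rintro c f ⟨hf, hf0⟩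
    refine ⟨?_, fun z hz => by simp [hf0 z hz]⟩
    simpa [mul_assoc] using hf.const_mul c

/-- The weight e^{-|Re z|/n} is at most 1, so convergence in norm forces uniform convergence of the
encoded functions, and Weierstrass' theorem applies. Completeness is needed later for Bochner
integrals with values in `boundedHolo n`. -/
theorem isClosed_boundedHolo (n : ℕ+) : IsClosed (boundedHolo n : Set (lp (fun _ : ℂ => ℂ) ∞)) := by
  refine isClosed_of_closure_subset fun f hf => ?_
  obtain ⟨u, hu, hlim⟩ := mem_closure_iff_seq_limit.mp hf
  have hlim' : TendstoUniformly (fun k z => u k z) (fun z => f z) atTop := by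
    rw [Metric.tendstoUniformly_iff]
    intro ε hε
    filter_upwards [Metric.tendsto_nhds.mp hlim ε hε] with k hk z
    rw [dist_comm, dist_eq_norm]
    rw [dist_eq_norm] at hk
    exact lt_of_le_of_lt (lp.norm_apply_le_norm (by simp) (u k - f) z) hk
  refine ⟨?_, fun z hz => ?_⟩
  · refine TendstoLocallyUniformlyOn.differentiableOn
      (F := fun k (z : ℂ) => u k z * (Real.exp (-(|z.re| / n)) : ℂ)) (φ := atTop) ?_
      (Eventually.of_forall fun k => (hu k).1) (isOpen_strip _)
    refine TendstoUniformlyOn.tendstoLocallyUniformlyOn ?_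
    rw [Metric.tendstoUniformlyOn_iff]
    intro ε hε
    filter_upwards [Metric.tendstoUniformly_iff.mp hlim' ε hε] with k hk z _
    rw [dist_eq_norm, ← sub_mul, norm_mul, Complex.norm_real, Real.norm_eq_abs, Real.abs_exp]
    refine lt_of_le_of_lt (mul_le_of_le_one_right (norm_nonneg _) ?_)
      (by simpa [dist_eq_norm] using hk z)
    exact Real.exp_le_one_iff.mpr (neg_nonpos.mpr (by positivity))
  · refine tendsto_nhds_unique (hlim'.tendsto_at z) ?_
    simp [(hu _).2 z hz]

instance (n : ℕ+) : CompleteSpace (boundedHolo n) :=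
  (isClosed_boundedHolo n).completeSpace_coe

/-- `F` is holomorphic on the strip `ℝ + i I_n` and `F z = O(e^{-|Re z|/n})`. -/
def IsBoundedHolo (n : ℕ+) (F : ℂ → ℂ) : Prop :=
  DifferentiableOn ℂ F (strip (n : ℝ)) ∧
    ∃ C : ℝ, ∀ z ∈ strip (n : ℝ), ‖F z‖ ≤ C * Real.exp (-(|z.re| / n))

theorem norm_mul_exp_le {n : ℕ+} {w : ℂ} {x C : ℝ}
    (h : ‖w‖ ≤ C * Real.exp (-(|x| / n))) : ‖w * (Real.exp (|x| / n) : ℂ)‖ ≤ C := by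
  rw [norm_mul, Complex.norm_real, Real.norm_eq_abs, Real.abs_exp]
  calc _ ≤ C * Real.exp (-(|x| / n)) * Real.exp (|x| / n) := by gcongr
    _ = C := by rw [mul_assoc, ← Real.exp_add]; simp

open Classical in
/-- The element of `boundedHolo n` given by a function that is holomorphic and bounded by
`e^{-|Re z|/n}` on the strip (and zero for other functions). -/
def ofHolo (n : ℕ+) (F : ℂ → ℂ) : boundedHolo n :=
  if hF : IsBoundedHolo n F then
    ⟨⟨(strip (n : ℝ)).indicator fun z => F z * (Real.exp (|z.re| / n) : ℂ), by
      obtain ⟨C, hC⟩ := hF.2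
      refine memℓp_infty ⟨max C 0, ?_⟩
      rintro _ ⟨z, rfl⟩
      by_cases hz : z ∈ strip (n : ℝ)
      · simp only [Set.indicator_of_mem hz]
        exact (norm_mul_exp_le (hC z hz)).trans (le_max_left _ _)
      · simp [Set.indicator_of_notMem hz]⟩, by
      refine ⟨hF.1.congr fun z hz => ?_, fun z hz => Set.indicator_of_notMem (f := fun z =>
        F z * (Real.exp (|z.re| / n) : ℂ)) hz⟩
      simp only [Set.indicator_of_mem hz]
      rw [mul_assoc, ← Complex.ofReal_mul, ← Real.exp_add]
      simp⟩
  else 0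

theorem ofHolo_apply {n : ℕ+} {F : ℂ → ℂ} (hF : IsBoundedHolo n F) {z : ℂ}
    (hz : z ∈ strip (n : ℝ)) : (ofHolo n F).1 z = F z * (Real.exp (|z.re| / n) : ℂ) := by
  simp only [ofHolo, hF, dif_pos]
  exact Set.indicator_of_mem hz _

theorem boundedHolo.norm_le {n : ℕ+} {f : boundedHolo n} {C : ℝ} (hC : 0 ≤ C)
    (h : ∀ z ∈ strip (n : ℝ), ‖f.1 z‖ ≤ C) : ‖f‖ ≤ C := by
  refine lp.norm_le_of_forall_le (f := f.1) hC fun z => ?_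
  by_cases hz : z ∈ strip (n : ℝ)
  · exact h z hz
  · rw [f.2.2 z hz]
    simpa using hC

theorem norm_ofHolo_le {n : ℕ+} {F : ℂ → ℂ} {C : ℝ} (hC : 0 ≤ C)
    (h : ∀ z ∈ strip (n : ℝ), ‖F z‖ ≤ C * Real.exp (-(|z.re| / n))) : ‖ofHolo n F‖ ≤ C := by
  by_cases hF : IsBoundedHolo n F
  · refine boundedHolo.norm_le hC fun z hz => ?_
    rw [ofHolo_apply hF hz]
    exact norm_mul_exp_le (h z hz)
  · simpa [ofHolo, hF] using hC

/-- The value at the real point `x` of the holomorphic function encoded by `f`. -/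
def realEval (n : ℕ+) (x : ℝ) : boundedHolo n →L[ℂ] ℂ :=
  (Real.exp (-(|x| / n)) : ℂ) •
    ((lp.evalCLM ℂ (fun _ : ℂ => ℂ) ∞ (x : ℂ)).comp (boundedHolo n).subtypeL)

theorem realEval_apply (n : ℕ+) (x : ℝ) (f : boundedHolo n) :
    realEval n x f = (Real.exp (-(|x| / n)) : ℂ) * f.1 x := rfl

theorem realEval_ofHolo {n : ℕ+} {F : ℂ → ℂ} (hF : IsBoundedHolo n F) (x : ℝ) :
    realEval n x (ofHolo n F) = F x := by
  rw [realEval_apply, ofHolo_apply hF (ofReal_mem_strip n x), mul_left_comm, ← Complex.ofReal_mul,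
    ← Real.exp_add]
  simp

/-- A family of holomorphic functions depends continuously on its parameter as an element of
`boundedHolo n` if it is jointly continuous up to the boundary of the strip and decays slightly
faster than `e^{-|Re z|/n}`, locally uniformly in the parameter. -/
theorem continuousAt_ofHolo {P : Type*} [TopologicalSpace P] {n : ℕ+} {Φ : P → ℂ → ℂ} {p₀ : P}
    {K : P → ℝ} {δ : ℝ} (hδ : 0 < δ) (hK : ContinuousAt K p₀)
    (hΦ : ∀ z : ℂ, |z.im| ≤ 1 / n → ContinuousAt (fun q : P × ℂ => Φ q.1 q.2) (p₀, z))
    (hholo : ∀ᶠ p in 𝓝 p₀, DifferentiableOn ℂ (Φ p) (strip (n : ℝ)))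
    (hb : ∀ᶠ p in 𝓝 p₀, ∀ z ∈ strip (n : ℝ), ‖Φ p z‖ ≤ K p * Real.exp (-(1 / n + δ) * |z.re|)) :
    ContinuousAt (fun p => ofHolo n (Φ p)) p₀ := by
  have hn : (0 : ℝ) < n := by exact_mod_cast n.pos
  have hK1 : ∀ᶠ p in 𝓝 p₀, K p ≤ K p₀ + 1 :=
    hK.eventually_le_const (by linarith)
  have hb' : ∀ᶠ p in 𝓝 p₀, ∀ z ∈ strip (n : ℝ),
      ‖Φ p z‖ ≤ (|K p₀| + 1) * Real.exp (-δ * |z.re|) * Real.exp (-(|z.re| / n)) := by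
    filter_upwards [hK1, hb] with p h1 h2 z hz
    rw [mul_assoc, ← Real.exp_add,
      show -δ * |z.re| + -(|z.re| / n) = -(1 / n + δ) * |z.re| by ring]
    exact (h2 z hz).trans (by gcongr; exact h1.trans (by gcongr; exact le_abs_self _))
  have hgood : ∀ᶠ p in 𝓝 p₀, IsBoundedHolo n (Φ p) := by
    filter_upwards [hb', hholo] with p h1 h2
    refine ⟨h2, |K p₀| + 1, fun z hz => (h1 z hz).trans ?_⟩
    gcongr
    exact mul_le_of_le_one_right (by positivity)
      (Real.exp_le_one_iff.mpr (by nlinarith [abs_nonneg z.re]))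
  rw [Metric.continuousAt_iff']
  intro ε hε
  -- The spare decay δ makes the part |Re z| > R uniformly small. The remaining closed rectangle is
  -- compact, which is why joint continuity is required up to the boundary of the strip.
  have htend : Tendsto (fun R : ℝ => 2 * (|K p₀| + 1) * Real.exp (-δ * R)) atTop (𝓝 0) := by
    have := Real.tendsto_exp_neg_atTop_nhds_zero.comp (tendsto_id.const_mul_atTop hδ)
    simpa [Function.comp_def, neg_mul] using this.const_mul (2 * (|K p₀| + 1))
  obtain ⟨R, hR⟩ := ((tendsto_order.mp htend).2 (ε / 2) (by positivity)).exists
  have hcomp : IsCompact {z : ℂ | z.re ∈ Set.Icc (-R) R ∧ z.im ∈ Set.Icc (-(1 / n : ℝ)) (1 / n)} :=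
    isCompact_Icc.reProdIm isCompact_Icc
  have hloc : ∀ᶠ p in 𝓝 p₀, ∀ z ∈ {z : ℂ | z.re ∈ Set.Icc (-R) R ∧
      z.im ∈ Set.Icc (-(1 / n : ℝ)) (1 / n)},
      ‖Φ p z - Φ p₀ z‖ < ε / 2 * Real.exp (-(|z.re| / n)) := by
    refine hcomp.eventually_forall_of_forall_eventually (P := fun p z =>
      ‖Φ p z - Φ p₀ z‖ < ε / 2 * Real.exp (-(|z.re| / n))) fun z hz => ?_
    have hz' : |z.im| ≤ 1 / n := abs_le.mpr hz.2
    have h1 := hΦ z hz'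
    have h2 : ContinuousAt (fun q : P × ℂ => Φ p₀ q.2) (p₀, z) :=
      ContinuousAt.comp (f := fun q : P × ℂ => (p₀, q.2)) (g := fun q : P × ℂ => Φ q.1 q.2) h1
        (by fun_prop)
    have h3 : ContinuousAt (fun q : P × ℂ => ε / 2 * Real.exp (-(|q.2.re| / n))) (p₀, z) := by
      fun_prop
    refine (h1.sub h2).norm.eventually_lt h3 ?_
    simpa using by positivity
  filter_upwards [hloc, hgood, hb'] with p h1 h2 h3
  have h0 : IsBoundedHolo n (Φ p₀) := hgood.self_of_nhds
  have h4 := hb'.self_of_nhds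
  rw [dist_eq_norm]
  refine lt_of_le_of_lt (boundedHolo.norm_le (C := ε / 2) (by positivity) fun z hz => ?_)
    (by linarith)
  change ‖(ofHolo n (Φ p)).1 z - (ofHolo n (Φ p₀)).1 z‖ ≤ ε / 2
  rw [ofHolo_apply h2 hz, ofHolo_apply h0 hz, ← sub_mul]
  refine norm_mul_exp_le ?_
  by_cases hzR : |z.re| ≤ R
  · exact (h1 z ⟨abs_le.mp hzR, hz.1.le, hz.2.le⟩).le
  · refine (norm_sub_le _ _).trans ((add_le_add (h3 z hz) (h4 z hz)).trans ?_)
    rw [← two_mul, ← mul_assoc, ← mul_assoc]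
    gcongr
    refine le_trans ?_ hR.le
    gcongr _ * ?_
    exact Real.exp_le_exp.mpr (by nlinarith)

/-- The test function `e^{-a·} F|_ℝ` given by an element of `boundedHolo n`. -/
def toWeighted (a : ℝ) (n : ℕ+) (f : boundedHolo n) : WeightedRapid a :=
  ⟨fun x => (Real.exp (-(a * x)) : ℂ) * realEval n x f, by
    have hn : (0 : ℝ) < n := by exact_mod_cast n.pos
    refine ⟨?_, n, fun z => f.1 z * Real.exp (-(|z.re| / n)),
      ⟨f.2.1, fun z hz => by simp [f.2.2 z hz], fun K _ _ ε hε => ⟨‖f‖, fun z _ => ?_⟩⟩,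
      fun x => ?_⟩
    · have h1 : ContDiff ℝ ∞ fun x : ℝ => realEval n x f := by
        have h2 : ContDiffOn ℝ ∞ (fun z : ℂ => f.1 z * (Real.exp (-(|z.re| / n)) : ℂ))
            (strip (n : ℝ)) := (f.2.1.contDiffOn (n := ∞) (isOpen_strip _)).restrict_scalars ℝ
        have h3 : ContDiff ℝ ∞ fun x : ℝ => (x : ℂ) := Complex.ofRealCLM.contDiff
        convert h2.comp_contDiff h3 (ofReal_mem_strip n) using 1
        funext x
        rw [realEval_apply, mul_comm]
        simp
      have h5 : ContDiff ℝ ∞ fun x : ℝ => Real.exp (-(a * x)) := by fun_prop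
      have h4 : ContDiff ℝ ∞ fun x : ℝ => ((Real.exp (-(a * x)) : ℝ) : ℂ) :=
        Complex.ofRealCLM.contDiff.comp h5
      exact h4.mul h1
    · rw [norm_mul, Complex.norm_real, Real.norm_eq_abs, Real.abs_exp]
      gcongr
      · exact lp.norm_apply_le_norm (by simp) f.1 z
      · have : |z.re| / n = 1 / n * |z.re| := by ring
        nlinarith [abs_nonneg z.re]
    · change (Real.exp (a * x) : ℂ) * ((Real.exp (-(a * x)) : ℂ) * realEval n x f) = _
      rw [← mul_assoc, ← Complex.ofReal_mul, ← Real.exp_add, realEval_apply]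
      simp [mul_comm]⟩

theorem toWeighted_apply (a : ℝ) (n : ℕ+) (f : boundedHolo n) (x : ℝ) :
    (toWeighted a n f) x = (Real.exp (-(a * x)) : ℂ) * realEval n x f := rfl

theorem WeightedRapid.ext {a : ℝ} {φ ψ : WeightedRapid a} (h : ∀ x, φ x = ψ x) : φ = ψ :=
  Subtype.ext (funext h)

/-- `boundedHolo n` embeds into `Õ^{-1/n}`. -/
def toHoloDecay (n : ℕ+) : boundedHolo n →ₗ[ℂ] HoloDecay (1 / (n : ℝ)) n where
  toFun f := ⟨fun z => f.1 z * Real.exp (-(|z.re| / n)), f.2.1, fun z hz => by simp [f.2.2 z hz],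
    fun K _ _ ε hε => ⟨‖f‖, fun z _ => by
      rw [norm_mul, Complex.norm_real, Real.norm_eq_abs, Real.abs_exp]
      gcongr
      · exact lp.norm_apply_le_norm (by simp) f.1 z
      · have : |z.re| / n = 1 / n * |z.re| := by ring
        nlinarith [abs_nonneg z.re]⟩⟩
  map_add' f g := Subtype.ext (funext fun z => add_mul _ _ _)
  map_smul' c f := Subtype.ext (funext fun z => mul_assoc _ _ _)

theorem withSeminorms_holoSeminorm (δ ν : ℝ) : WithSeminorms (holoSeminorm δ ν) := ⟨rfl⟩

theorem holoSeminorm_toHoloDecay_le (n : ℕ+) (i : SeminormIndex n) (f : boundedHolo n) :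
    holoSeminorm (1 / (n : ℝ)) n i (toHoloDecay n f) ≤ ‖f‖ := by
  refine Real.iSup_le (fun z => ?_) (norm_nonneg _)
  change ‖f.1 z.1 * (Real.exp (-(|z.1.re| / n)) : ℂ)‖ * _ ≤ _
  rw [norm_mul, Complex.norm_real, Real.norm_eq_abs, Real.abs_exp, mul_assoc, ← Real.exp_add]
  refine (mul_le_of_le_one_right (norm_nonneg _) ?_).trans (lp.norm_apply_le_norm (by simp) f.1 _)
  refine Real.exp_le_one_iff.mpr ?_
  have h1 : |z.1.re| / n = 1 / n * |z.1.re| := by ring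
  have h2 := mul_nonneg i.2.2.le (abs_nonneg z.1.re)
  rw [h1]
  linarith [sub_mul (1 / (n : ℝ)) i.2.1 |z.1.re|]

theorem continuous_toHoloDecay (n : ℕ+) : Continuous (toHoloDecay n) := by
  refine WithSeminorms.continuous_of_isBounded (norm_withSeminorms ℂ (boundedHolo n))
    (withSeminorms_holoSeminorm _ _) _ fun i => ⟨{0}, 1, fun f => ?_⟩
  simpa using holoSeminorm_toHoloDecay_le n i f

variable {X : Type*} [NormedAddCommGroup X] [NormedSpace ℂ X] {a : ℝ}

/-- This is the only property of the inductive limit topology that the proof uses. -/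
theorem continuous_toRapid (n : ℕ+) : Continuous (toRapid n) :=
  continuous_sInf_rng.mpr fun _ ht => ht.2.2.2 n

theorem continuous_toWeighted (a : ℝ) (n : ℕ+) : Continuous (toWeighted a n) := by
  refine continuous_induced_rng.mpr ?_
  refine ((continuous_toRapid n).comp (continuous_toHoloDecay n)).congr fun f => ?_
  refine Subtype.ext (funext fun x => ?_)
  change f.1 x * (Real.exp (-(|x| / n)) : ℂ) =
    (Real.exp (a * x) : ℂ) * ((Real.exp (-(a * x)) : ℂ) * realEval n x f)
  rw [← mul_assoc, ← Complex.ofReal_mul, ← Real.exp_add, realEval_apply, mul_comm]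
  simp

/-- The restriction of `G ∈ 𝒬_a` to the Banach space `boundedHolo n`. -/
def Q.restrict (G : Q a X) (n : ℕ+) : boundedHolo n →L[ℂ] X where
  toFun f := G (toWeighted a n f)
  map_add' f g := by
    rw [← map_add]
    congr 1
    refine WeightedRapid.ext fun x => ?_
    change _ = (toWeighted a n f) x + (toWeighted a n g) x
    simp only [toWeighted_apply, map_add, mul_add]
  map_smul' c f := by
    rw [RingHom.id_apply, ← map_smul]
    congr 1
    refine WeightedRapid.ext fun x => ?_
    change _ = c * (toWeighted a n f) x
    simp only [toWeighted_apply, map_smul, smul_eq_mul, mul_left_comm]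
  cont := G.continuous.comp (continuous_toWeighted a n)

/-- Test functions are functions on ℝ, so identities under `G` need checking only at real points,
even between different strips. -/
theorem Q.restrict_congr (G : Q a X) {n m : ℕ+} {f : boundedHolo n} {g : boundedHolo m}
    (h : ∀ x, realEval n x f = realEval m x g) : G.restrict n f = G.restrict m g := by
  change G _ = G _
  congr 1
  exact WeightedRapid.ext fun x => by simp only [toWeighted_apply, h]

theorem Q.restrict_eq (G : Q a X) {n : ℕ+} {f : boundedHolo n} {φ : WeightedRapid a}
    (h : ∀ x : ℝ, realEval n x f = (Real.exp (a * x) : ℂ) * φ x) : G.restrict n f = G φ := by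
  change G _ = G _
  congr 1
  refine WeightedRapid.ext fun x => ?_
  rw [toWeighted_apply, h, ← mul_assoc, ← Complex.ofReal_mul, ← Real.exp_add]
  simp

end

/-! ### Laws of infinite sums of independent exponential variables. -/

section

open ProbabilityTheory

/-- Tilting the exponential density of rate 1 by e^{ux} gives (1-u)⁻¹ times the density of rate 1-u.
-/
theorem lintegral_exp_mul_expMeasure {u : ℝ} (hu : u < 1) :
    ∫⁻ x, ENNReal.ofReal (Real.exp (u * x)) ∂expMeasure 1 = ENNReal.ofReal (1 - u)⁻¹ := by
  have h1 : 0 < 1 - u := by linarith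
  have hm : ∀ r : ℝ, Measurable (exponentialPDF r) := fun r =>
    (measurable_exponentialPDFReal r).ennreal_ofReal
  have hexp : expMeasure 1 = volume.withDensity (exponentialPDF 1) := rfl
  rw [hexp, lintegral_withDensity_eq_lintegral_mul _ (hm 1) (by fun_prop)]
  have : ∀ x, (exponentialPDF 1 * fun x => ENNReal.ofReal (Real.exp (u * x))) x =
      ENNReal.ofReal (1 - u)⁻¹ * exponentialPDF (1 - u) x := by
    intro x
    simp only [Pi.mul_apply]
    rcases lt_or_ge x 0 with hx | hx
    · simp [exponentialPDF_of_neg hx]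
    · rw [exponentialPDF_of_nonneg hx, exponentialPDF_of_nonneg hx,
        ← ENNReal.ofReal_mul (by positivity), ← ENNReal.ofReal_mul (by positivity),
        ← mul_assoc, inv_mul_cancel₀ h1.ne', one_mul, one_mul, ← Real.exp_add]
      ring_nf
  simp_rw [this]
  rw [lintegral_const_mul _ (hm _), lintegral_exponentialPDF_eq_one h1, mul_one]

theorem mgf_id_expMeasure {u : ℝ} (hu : u < 1) : mgf id (expMeasure 1) u = (1 - u)⁻¹ := by
  have h1 : 0 < 1 - u := by linarith
  rw [mgf, integral_eq_lintegral_of_nonneg_ae (ae_of_all _ fun x => (Real.exp_pos _).le)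
    (by fun_prop)]
  simp only [id]
  rw [lintegral_exp_mul_expMeasure hu, ENNReal.toReal_ofReal (by positivity)]

theorem ae_pos_expMeasure : ∀ᵐ x ∂expMeasure 1, 0 < x := by
  have hexp : expMeasure 1 = volume.withDensity (exponentialPDF 1) := rfl
  have hm : Measurable (exponentialPDF 1) := (measurable_exponentialPDFReal 1).ennreal_ofReal
  rw [hexp, ae_withDensity_iff hm]
  filter_upwards [(volume : Measure ℝ).ae_ne 0] with x hx h
  by_contra h'
  exact h (exponentialPDF_of_neg (lt_of_le_of_ne (not_lt.mp h') hx))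

/-- The law of `∑ a_j X_j`, with independent standard exponential variables `X_j`. -/
theorem exists_exponential_mixture {c : ℕ → ℝ} (hc0 : ∀ j, 0 < c j) (hc1 : ∀ j, c j ≤ 1 / 2)
    (hc : Summable c) :
    ∃ μ : Measure ℝ, IsProbabilityMeasure μ ∧ (∀ᵐ t ∂μ, 0 < t) ∧ Integrable Real.exp μ ∧
      ∀ s : ℝ, 0 ≤ s → Tendsto (fun n => ∏ j ∈ Finset.range n, (1 + s * c j)⁻¹) atTop
        (𝓝 (∫ t, Real.exp (-s * t) ∂μ)) := by
  have : IsProbabilityMeasure (expMeasure 1) := isProbabilityMeasure_expMeasure one_pos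
  let P : Measure (ℕ → ℝ) := Measure.infinitePi fun _ => expMeasure 1
  let S : ℕ → (ℕ → ℝ) → ℝ := fun n y => ∑ j ∈ Finset.range n, c j * y j
  have hSm : ∀ n, Measurable (S n) := fun n => by fun_prop
  have hpos : ∀ᵐ y ∂P, ∀ j, 0 < y j := by
    refine ae_all_iff.mpr fun j => ?_
    have h := ae_pos_expMeasure
    rw [← Measure.infinitePi_map_eval (fun _ : ℕ => expMeasure 1) j] at h
    exact ae_of_ae_map (measurable_pi_apply j).aemeasurable h
  -- Used twice: u = 1 gives a uniform exponential moment, u = -s the Laplace transform.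
  have hmgf : ∀ u : ℝ, u ≤ 1 → ∀ n, ∫ y, Real.exp (u * S n y) ∂P =
      ∏ j ∈ Finset.range n, (1 - u * c j)⁻¹ := by
    intro u hu n
    have hind : iIndepFun (fun (j : ℕ) (y : ℕ → ℝ) => c j * y j) P :=
      iIndepFun_infinitePi (P := fun _ : ℕ => expMeasure 1) (X := fun j x => c j * x)
        fun j => by fun_prop
    have h := hind.mgf_sum (t := u) (fun j => by fun_prop) (Finset.range n)
    have h2 : ∀ j, mgf (fun y : ℕ → ℝ => c j * y j) P u = (1 - u * c j)⁻¹ := by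
      intro j
      have huc : u * c j < 1 := by nlinarith [hc0 j, hc1 j]
      rw [← mgf_id_expMeasure huc, ← Measure.infinitePi_map_eval (fun _ : ℕ => expMeasure 1) j,
        mgf_id_map (measurable_pi_apply j).aemeasurable, mgf, mgf]
      congr 1
      funext y
      ring_nf
    simp_rw [h2] at h
    rw [← h, mgf]
    simp [S]
  have hmono : ∀ᵐ y ∂P, Monotone fun n => S n y := by
    filter_upwards [hpos] with y hy
    refine monotone_nat_of_le_succ fun n => ?_
    simp only [S, Finset.sum_range_succ]
    nlinarith [hy n, hc0 n, mul_pos (hy n) (hc0 n)]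
  have hbound : ∀ n, ∫⁻ y, ENNReal.ofReal (Real.exp (S n y)) ∂P ≤
      ENNReal.ofReal (Real.exp (2 * ∑' j, c j)) := by
    intro n
    have h := hmgf 1 le_rfl n
    simp only [one_mul] at h
    have hp : 0 < ∏ j ∈ Finset.range n, (1 - c j)⁻¹ :=
      Finset.prod_pos fun j _ => inv_pos.mpr (by linarith [hc1 j])
    -- A nonintegrable function has Bochner integral 0, so a positive value already proves
    -- integrability.
    have hint : Integrable (fun y => Real.exp (S n y)) P :=
      Integrable.of_integral_ne_zero (by rw [h]; exact hp.ne')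
    rw [← ofReal_integral_eq_lintegral_ofReal hint (ae_of_all _ fun _ => (Real.exp_pos _).le), h]
    refine ENNReal.ofReal_le_ofReal ?_
    -- For 0 < c ≤ 1/2 one has 1/(1-c) ≤ 1 + 2c ≤ e^{2c}.
    calc ∏ j ∈ Finset.range n, (1 - c j)⁻¹ ≤ ∏ j ∈ Finset.range n, Real.exp (2 * c j) := by
          refine Finset.prod_le_prod (fun j _ => inv_nonneg.mpr (by linarith [hc1 j])) fun j _ => ?_
          refine le_trans ?_ (Real.add_one_le_exp (2 * c j))
          rw [inv_le_iff_one_le_mul₀ (by linarith [hc1 j])]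
          nlinarith [hc0 j, hc1 j]
      _ = Real.exp (2 * ∑ j ∈ Finset.range n, c j) := by rw [← Real.exp_sum, Finset.mul_sum]
      _ ≤ _ := by
          gcongr
          exact hc.sum_le_tsum _ fun j _ => (hc0 j).le
  have hsup : ∫⁻ y, ⨆ n, ENNReal.ofReal (Real.exp (S n y)) ∂P ≤
      ENNReal.ofReal (Real.exp (2 * ∑' j, c j)) := by
    rw [lintegral_iSup' (fun n => by fun_prop)]
    · exact iSup_le hbound
    · filter_upwards [hmono] with y hy n m hnm
      exact ENNReal.ofReal_le_ofReal (Real.exp_le_exp.mpr (hy hnm))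
  have hfin : ∀ᵐ y ∂P, ⨆ n, ENNReal.ofReal (Real.exp (S n y)) < ⊤ :=
    ae_lt_top (Measurable.iSup fun n => by fun_prop) (ne_top_of_le_ne_top ENNReal.ofReal_ne_top hsup)
  let T : (ℕ → ℝ) → ℝ := fun y => ∑' j, c j * y j
  -- The series has positive terms, and its partial sums are bounded almost surely because sup
  -- e^{S_n} has finite expectation.
  have hlim : ∀ᵐ y ∂P, Tendsto (fun n => S n y) atTop (𝓝 (T y)) := by
    filter_upwards [hfin, hpos] with y h1 h2
    refine (summable_of_sum_range_le (c := (⨆ n, ENNReal.ofReal (Real.exp (S n y))).toReal)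
      (fun j => (mul_pos (hc0 j) (h2 j)).le) fun n => ?_).hasSum.tendsto_sum_nat
    have h3 : ENNReal.ofReal (Real.exp (S n y)) ≤ ⨆ n, ENNReal.ofReal (Real.exp (S n y)) :=
      le_iSup (fun n => ENNReal.ofReal (Real.exp (S n y))) n
    have h4 := (ENNReal.ofReal_le_iff_le_toReal h1.ne).mp h3
    linarith [Real.add_one_le_exp (S n y)]
  have hTm : AEMeasurable T P :=
    aemeasurable_of_tendsto_metrizable_ae atTop (fun n => (hSm n).aemeasurable) hlim
  refine ⟨P.map T, Measure.isProbabilityMeasure_map hTm, ?_, ?_, fun s hs => ?_⟩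
  · rw [ae_map_iff hTm measurableSet_Ioi]
    filter_upwards [hlim, hmono, hpos] with y h1 h2 h3
    refine lt_of_lt_of_le ?_ (h2.ge_of_tendsto h1 1)
    simpa [S] using mul_pos (hc0 0) (h3 0)
  · rw [integrable_map_measure (by fun_prop) hTm]
    refine ⟨(Real.measurable_exp.comp_aemeasurable hTm).aestronglyMeasurable, ?_⟩
    change HasFiniteIntegral (fun y => Real.exp (T y)) P
    rw [hasFiniteIntegral_iff_ofReal (ae_of_all _ fun _ => (Real.exp_pos _).le)]
    refine lt_of_le_of_lt (lintegral_mono_ae ?_) (hsup.trans_lt ENNReal.ofReal_lt_top)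
    filter_upwards [hlim] with y h1
    refine le_of_tendsto' ((ENNReal.continuous_ofReal.comp Real.continuous_exp).continuousAt.tendsto.comp
      h1) fun n => ?_
    exact le_iSup (fun n => ENNReal.ofReal (Real.exp (S n y))) n
  · rw [integral_map hTm (by fun_prop)]
    have h : ∀ n, ∏ j ∈ Finset.range n, (1 + s * c j)⁻¹ = ∫ y, Real.exp (-s * S n y) ∂P := by
      intro n
      rw [hmgf (-s) (by linarith) n]
      simp
    simp_rw [h]
    refine tendsto_integral_of_dominated_convergence (fun _ => 1) (fun n => by fun_prop)
      (integrable_const _) (fun n => ?_) ?_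
    · filter_upwards [hpos] with y hy
      rw [Real.norm_eq_abs, Real.abs_exp, Real.exp_le_one_iff]
      have : 0 ≤ S n y := Finset.sum_nonneg fun j _ => (mul_pos (hc0 j) (hy j)).le
      nlinarith
    · filter_upwards [hlim] with y hy
      exact (Real.continuous_exp.tendsto _).comp (hy.const_mul _)

end

/-! ### The singularity at time zero and the choice of the coefficients c_j. -/

section

/-- Diagonal choice of a slowly growing sequence. -/
theorem exists_slow_sequence {p : ℕ → ℕ → Prop} (hp : ∀ q, ∀ᶠ k in atTop, p q k) :
    ∃ r : ℕ → ℕ, Monotone r ∧ Tendsto r atTop atTop ∧ ∀ᶠ k in atTop, p (r k) k := by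
  classical
  -- Requiring `p q` from `k` onwards makes `P` monotone in `k`, and hence the greatest admissible
  -- `q` monotone as well.
  let P : ℕ → ℕ → Prop := fun k q => ∀ k' ≥ k, p q k'
  have hP : ∀ q, ∃ k₀, ∀ k ≥ k₀, P k q := by
    intro q
    obtain ⟨k₀, hk₀⟩ := eventually_atTop.mp (hp q)
    exact ⟨k₀, fun k hk k' hk' => hk₀ k' (hk.trans hk')⟩
  refine ⟨fun k => Nat.findGreatest (P k) k, fun k l hkl => ?_, ?_, ?_⟩
  · exact Nat.findGreatest_mono (fun q hq k' hk' => hq k' (hkl.trans hk')) hkl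
  · refine tendsto_atTop.mpr fun q => ?_
    obtain ⟨k₀, hk₀⟩ := hP q
    filter_upwards [eventually_ge_atTop k₀, eventually_ge_atTop q] with k h1 h2
    exact Nat.le_findGreatest h2 (hk₀ k h1)
  · obtain ⟨k₀, hk₀⟩ := hP 0
    filter_upwards [eventually_ge_atTop k₀] with k h1
    exact Nat.findGreatest_spec (P := P k) (Nat.zero_le k) (hk₀ k h1) k le_rfl

/-- The lower envelope of the bounds `B_q e^{2/((q+1)² t)}`. -/
def envelope (B : ℕ → ℝ) (t : ℝ) : ℝ := ⨅ q : ℕ, B q * Real.exp (2 / (((q : ℝ) + 1) ^ 2 * t))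

theorem envelope_le {B : ℕ → ℝ} (hB : ∀ q, 1 ≤ B q) (q : ℕ) (t : ℝ) :
    envelope B t ≤ B q * Real.exp (2 / (((q : ℝ) + 1) ^ 2 * t)) := by
  refine ciInf_le ⟨0, ?_⟩ q
  rintro _ ⟨q, rfl⟩
  have := hB q
  positivity

theorem envelope_nonneg {B : ℕ → ℝ} (hB : ∀ q, 1 ≤ B q) (t : ℝ) : 0 ≤ envelope B t :=
  Real.iInf_nonneg fun q => by
    have := hB q
    positivity

theorem measurable_envelope {B : ℕ → ℝ} : Measurable (envelope B) :=
  Measurable.iInf fun q => by fun_prop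

/-- Choice of coefficients of an infinite product that grows faster than the envelope, although
it is of exponential type zero. -/
theorem exists_coefficients {B : ℕ → ℝ} (hB : ∀ q, 1 ≤ B q) :
    ∃ c : ℕ → ℝ, (∀ j, 0 < c j) ∧ (∀ j, c j ≤ 1 / 2) ∧ Summable c ∧
      Tendsto (fun j : ℕ => c j * ((j : ℝ) + 1) ^ 2) atTop (𝓝 0) ∧
      ∃ s A : ℕ → ℝ, ∃ k₀ : ℕ, 0 < k₀ ∧ ∀ k ≥ k₀, 0 ≤ s k ∧ 0 ≤ A k ∧
        (∀ t : ℝ, 1 / ((k : ℝ) + 1) ≤ t → t ≤ 1 / k → envelope B t ≤ A k * Real.exp (-s k * t)) ∧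
        ∃ m, A k * ∏ j ∈ Finset.range m, (1 + s k * c j)⁻¹ ≤
          Real.exp 2 * (1 / ((k : ℝ) + 1) ^ 2) := by
  -- With R_k = (r_k + 1)², r tends to infinity so slowly that B_{r_k} ≤ e^{k/R_k}, (k+1)² ≤
  -- e^{k/R_k} and R_k ≤ k. On 1/(k+1) ≤ t ≤ 1/k the envelope is then at most e^{(3k+2)/R_k}.
  obtain ⟨r, hr, hr', hev⟩ := exists_slow_sequence
    (p := fun q k => B q ≤ Real.exp (k / ((q : ℝ) + 1) ^ 2) ∧
      ((k : ℝ) + 1) ^ 2 ≤ Real.exp (k / ((q : ℝ) + 1) ^ 2) ∧ ((q : ℝ) + 1) ^ 2 ≤ k) (by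
    intro q
    have hR : (0 : ℝ) < ((q : ℝ) + 1) ^ 2 := by positivity
    have h1 : Tendsto (fun k : ℕ => (k : ℝ) / ((q : ℝ) + 1) ^ 2) atTop atTop :=
      tendsto_natCast_atTop_atTop.atTop_div_const hR
    refine ((Real.tendsto_exp_atTop.comp h1).eventually_ge_atTop _).and (Eventually.and ?_
      (tendsto_natCast_atTop_atTop.eventually_ge_atTop _))
    have h2 := (Real.tendsto_exp_div_pow_atTop 2).comp h1
    filter_upwards [h2.eventually_ge_atTop (4 * (((q : ℝ) + 1) ^ 2) ^ 2),
      eventually_ge_atTop 1] with k hk hk1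
    have hk2 : (1 : ℝ) ≤ k := by exact_mod_cast hk1
    simp only [Function.comp_apply] at hk
    rw [le_div_iff₀ (by positivity), div_pow, ← mul_div_assoc, mul_div_right_comm,
      mul_div_cancel_right₀ _ (by positivity)] at hk
    nlinarith)
  let R : ℕ → ℝ := fun k => ((r k : ℝ) + 1) ^ 2
  have hR1 : ∀ k, 1 ≤ R k := fun k => by
    have : (0 : ℝ) ≤ r k := by positivity
    simp only [R]
    nlinarith
  have hRm : Monotone R := fun k l hkl => by
    have : (r k : ℝ) ≤ r l := by exact_mod_cast hr hkl
    simp only [R]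
    gcongr
  have hRt : Tendsto R atTop atTop := by
    refine tendsto_atTop_mono (fun k => ?_) (tendsto_natCast_atTop_atTop.comp hr')
    simp only [R, Function.comp_apply]
    nlinarith [(Nat.cast_nonneg (r k) : (0 : ℝ) ≤ r k)]
  -- At s = k²/R_k each of the first m ≈ 10k/R_k factors of ∏ (1 + s c_j)⁻¹ is at most 1/2 ≤
  -- e^{-1/2}; here 200 exceeds 11², from R_k m ≤ 11k. Their product e^{-5k/R_k} beats A_k =
  -- e^{(4k+2)/R_k} and leaves e^{-k/R_k} ≤ (k+1)⁻², which is summable.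
  let c : ℕ → ℝ := fun j => min (1 / 2) (200 / (R j * ((j : ℝ) + 1) ^ 2))
  have hc0 : ∀ j, 0 < c j := fun j => by
    have := hR1 j
    exact lt_min (by norm_num) (by positivity)
  refine ⟨c, hc0, fun j => min_le_left _ _, ?_, ?_, fun k => (k : ℝ) ^ 2 / R k,
    fun k => Real.exp ((4 * k + 2) / R k), ?_⟩
  · have h1 : Summable fun j : ℕ => 200 * (1 / ((j : ℝ) + 1) ^ 2) := by
      refine Summable.mul_left _ ?_
      have := (summable_nat_add_iff 1).mpr (Real.summable_one_div_nat_pow.mpr one_lt_two)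
      simpa using this
    refine h1.of_nonneg_of_le (fun j => (hc0 j).le) fun j => (min_le_right _ _).trans ?_
    rw [mul_one_div]
    gcongr
    exact le_mul_of_one_le_left (by positivity) (hR1 j)
  · refine squeeze_zero (g := fun j => 200 / R j) (fun j => by have := hc0 j; positivity)
      (fun j => ?_) (hRt.const_div_atTop 200)
    have := hR1 j
    calc c j * ((j : ℝ) + 1) ^ 2 ≤ 200 / (R j * ((j : ℝ) + 1) ^ 2) * ((j : ℝ) + 1) ^ 2 := by
          gcongr
          exact min_le_right _ _
      _ = 200 / R j := by field_simp
  obtain ⟨k₀, hk₀⟩ := eventually_atTop.mp (hev.and ((hRt.eventually_ge_atTop 11).and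
    (eventually_ge_atTop 2)))
  refine ⟨max k₀ 1, by positivity, fun k hk => ?_⟩
  obtain ⟨⟨h1, h2, h3⟩, h4, h5⟩ := hk₀ k (le_trans (le_max_left _ _) hk)
  have hk2 : (2 : ℝ) ≤ k := by exact_mod_cast h5
  have hRk : 0 < R k := by linarith
  change B (r k) ≤ Real.exp (k / R k) at h1
  change _ ≤ Real.exp (k / R k) at h2
  change R k ≤ k at h3
  refine ⟨by positivity, by positivity, fun t ht1 ht2 => ?_, ?_⟩
  · have ht : 0 < t := lt_of_lt_of_le (by positivity) ht1
    have h6 : 2 / (R k * t) ≤ 2 * (k + 1) / R k := by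
      rw [div_le_div_iff₀ (by positivity) hRk]
      rw [div_le_iff₀ (by positivity)] at ht1
      nlinarith [mul_le_mul_of_nonneg_left ht1 hRk.le]
    have h7 : (k : ℝ) ^ 2 / R k * t ≤ k / R k := by
      rw [le_div_iff₀ (by positivity)] at ht2
      rw [div_mul_eq_mul_div]
      gcongr
      nlinarith
    calc envelope B t ≤ B (r k) * Real.exp (2 / (R k * t)) := envelope_le hB _ _
      _ ≤ Real.exp (k / R k) * Real.exp (2 * (k + 1) / R k) := by gcongr
      _ ≤ Real.exp ((4 * k + 2) / R k) * Real.exp (-(k / R k)) := by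
          rw [← Real.exp_add, ← Real.exp_add]
          refine Real.exp_le_exp.mpr (le_of_eq ?_)
          ring
      _ ≤ _ := by
          gcongr
          linarith
  · let m := ⌈10 * (k : ℝ) / R k⌉₊
    have hm1 : 10 * (k : ℝ) / R k ≤ m := Nat.le_ceil _
    have hm2 : (m : ℝ) < 10 * (k : ℝ) / R k + 1 := Nat.ceil_lt_add_one (by positivity)
    have hm3 : R k * m ≤ 11 * k := by
      have : R k * m ≤ R k * (10 * (k : ℝ) / R k + 1) := by gcongr
      rw [mul_add, mul_div_cancel₀ _ hRk.ne'] at this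
      linarith
    -- This uses R_k ≥ 11; it places every j < m below k, where R_j ≤ R_k.
    have hm4 : (m : ℝ) ≤ k := by nlinarith [(Nat.cast_nonneg m : (0 : ℝ) ≤ m)]
    have hm5 : m ≤ k := by exact_mod_cast hm4
    have hfac : ∀ j ∈ Finset.range m, (1 + (k : ℝ) ^ 2 / R k * c j)⁻¹ ≤ Real.exp (-(1 / 2)) := by
      intro j hj
      have hjm : (j : ℝ) + 1 ≤ m := by exact_mod_cast Finset.mem_range.mp hj
      have hjk : R j ≤ R k := hRm ((Finset.mem_range.mp hj).le.trans hm5)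
      have hge : 1 ≤ (k : ℝ) ^ 2 / R k * c j := by
        have hj1 := hR1 j
        rw [mul_min_of_nonneg _ _ (by positivity)]
        refine le_min ?_ ?_
        · rw [div_mul_div_comm, le_div_iff₀ (by positivity)]
          nlinarith
        · rw [div_mul_div_comm, le_div_iff₀ (by positivity), one_mul]
          calc R k * (R j * ((j : ℝ) + 1) ^ 2) ≤ R k * (R k * (m : ℝ) ^ 2) := by gcongr
            _ = (R k * m) ^ 2 := by ring
            _ ≤ (11 * k) ^ 2 := by gcongr
            _ ≤ _ := by nlinarith
      have he : Real.exp (1 / 2) ≤ 2 := by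
        have h8 : Real.exp (1 / 2) ^ 2 = Real.exp 1 := by
          rw [← Real.exp_nat_mul]
          norm_num
        nlinarith [Real.exp_one_lt_d9, Real.exp_pos (1 / 2)]
      rw [Real.exp_neg]
      gcongr
      linarith
    refine ⟨m, ?_⟩
    calc Real.exp ((4 * k + 2) / R k) * ∏ j ∈ Finset.range m, (1 + (k : ℝ) ^ 2 / R k * c j)⁻¹
        ≤ Real.exp ((4 * k + 2) / R k) * ∏ j ∈ Finset.range m, Real.exp (-(1 / 2)) := by
          gcongr with j hj
          exact hfac j hj
      _ = Real.exp ((4 * k + 2) / R k + m * (-(1 / 2))) := by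
          rw [Finset.prod_const, Finset.card_range, ← Real.exp_nat_mul, ← Real.exp_add]
      _ ≤ Real.exp (2 + -(k / R k)) := by
          refine Real.exp_le_exp.mpr ?_
          have e1 : (4 * k + 2) / R k = 4 * (k / R k) + 2 / R k := by ring
          have e2 : 2 / R k ≤ 2 := div_le_self (by norm_num) (by linarith)
          have e3 : 10 * (k : ℝ) / R k = 10 * (k / R k) := by ring
          rw [e3] at hm1
          linarith
      _ ≤ _ := by
          rw [Real.exp_add, Real.exp_neg, one_div]
          gcongr

/-- A subordinator law adapted to the envelope. -/
theorem exists_adapted_mixture {B : ℕ → ℝ} (hB : ∀ q, 1 ≤ B q) :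
    ∃ (c : ℕ → ℝ) (μ : Measure ℝ), (∀ j, 0 < c j) ∧ Summable c ∧
      Tendsto (fun j : ℕ => c j * ((j : ℝ) + 1) ^ 2) atTop (𝓝 0) ∧
      IsProbabilityMeasure μ ∧ (∀ᵐ t ∂μ, 0 < t) ∧ Integrable Real.exp μ ∧
      (∀ s : ℝ, 0 ≤ s → Tendsto (fun n => ∏ j ∈ Finset.range n, (1 + s * c j)⁻¹) atTop
        (𝓝 (∫ t, Real.exp (-s * t) ∂μ))) ∧
      Integrable (fun t => envelope B t * Real.exp t) μ := by
  obtain ⟨c, hc0, hc1, hc, hct, s, A, k₀, hk₀, hk⟩ := exists_coefficients hB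
  obtain ⟨μ, hμ, hpos, hexp, hlap⟩ := exists_exponential_mixture hc0 hc1 hc
  refine ⟨c, μ, hc0, hc, hct, hμ, hpos, hexp, hlap, ?_⟩
  have hk₀' : (1 : ℝ) ≤ k₀ := by exact_mod_cast hk₀
  have hint : ∀ k ≥ k₀, Integrable (fun t => Real.exp (-s k * t)) μ := by
    intro k hkk
    refine (integrable_const (1 : ℝ)).mono' (by fun_prop) ?_
    filter_upwards [hpos] with t ht
    rw [Real.norm_eq_abs, Real.abs_exp, Real.exp_le_one_iff]
    nlinarith [(hk k hkk).1]
  -- A Chernoff bound on each interval [1/(k+1), 1/k]: there the envelope lies below one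
  -- exponential, whose μ-integral is a value of the Laplace transform. Summing over k covers 0 < t
  -- ≤ 1/k₀.
  let g : ℕ → ℝ → ℝ := fun k t => A (k + k₀) * Real.exp (-s (k + k₀) * t)
  have hg0 : ∀ k t, 0 ≤ g k t := fun k t => by
    have := (hk (k + k₀) (by omega)).2.1
    positivity
  have hgint : ∀ k, Integrable (g k) μ := fun k => (hint _ (by omega)).const_mul _
  have hgle : ∀ k, ∫ t, g k t ∂μ ≤ Real.exp 2 * (1 / (((k + k₀ : ℕ) : ℝ) + 1) ^ 2) := by
    intro k
    obtain ⟨h1, h2, -, m, hm⟩ := hk (k + k₀) (by omega)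
    simp only [g]
    rw [integral_const_mul]
    refine le_trans (mul_le_mul_of_nonneg_left ?_ h2) hm
    -- The partial products decrease, so the Laplace transform is at most the product of the first
    -- `m` factors.
    refine Antitone.le_of_tendsto (antitone_nat_of_succ_le fun n => ?_) (hlap _ h1) m
    have h3 : ∀ j, 0 ≤ (1 + s (k + k₀) * c j)⁻¹ := fun j =>
      inv_nonneg.mpr (by have := hc0 j; positivity)
    rw [Finset.prod_range_succ]
    refine mul_le_of_le_one_right (Finset.prod_nonneg fun j _ => h3 j) (inv_le_one_of_one_le₀ ?_)
    have := mul_nonneg h1 (hc0 n).le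
    linarith
  have hsum : ∑' k, ENNReal.ofReal (∫ t, g k t ∂μ) ≠ ⊤ := by
    have h1 : Summable fun k : ℕ => Real.exp 2 * (1 / (((k + k₀ : ℕ) : ℝ) + 1) ^ 2) := by
      refine Summable.mul_left _ ?_
      have := (summable_nat_add_iff (k₀ + 1)).mpr (Real.summable_one_div_nat_pow.mpr one_lt_two)
      refine this.congr fun k => ?_
      push_cast
      ring
    exact (h1.of_nonneg_of_le (fun k => integral_nonneg (hg0 k)) hgle).tsum_ofReal_ne_top
  have hgfin : ∫⁻ t, ∑' k, ENNReal.ofReal (g k t) ∂μ ≠ ⊤ := by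
    rw [lintegral_tsum fun k => (by fun_prop)]
    convert hsum using 3 with k
    exact (ofReal_integral_eq_lintegral_ofReal (hgint k) (ae_of_all _ (hg0 k))).symm
  refine ⟨(measurable_envelope.mul Real.measurable_exp).aestronglyMeasurable, ?_⟩
  have hnn : ∀ t, 0 ≤ envelope B t * Real.exp t := fun t =>
    mul_nonneg (envelope_nonneg hB t) (Real.exp_pos t).le
  rw [hasFiniteIntegral_iff_ofReal (ae_of_all _ hnn)]
  let D : ℝ := B 0 * Real.exp (2 * k₀)
  have hD : 0 ≤ D := by have := hB 0; positivity
  have hle : ∀ᵐ t ∂μ, ENNReal.ofReal (envelope B t * Real.exp t) ≤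
      ENNReal.ofReal (D * Real.exp t) +
        ENNReal.ofReal (Real.exp 1) * ∑' k, ENNReal.ofReal (g k t) := by
    filter_upwards [hpos] with t ht
    rcases lt_or_ge (1 / (k₀ : ℝ)) t with h | h
    · refine le_add_right (ENNReal.ofReal_le_ofReal ?_)
      gcongr
      refine (envelope_le hB 0 t).trans ?_
      simp only [D]
      have := hB 0
      gcongr
      rw [div_lt_iff₀ (by positivity)] at h
      rw [div_le_iff₀ (by positivity)]
      norm_num
      nlinarith
    · refine le_add_left ?_
      let k := ⌊1 / t⌋₊
      have hkt : (k : ℝ) ≤ 1 / t := Nat.floor_le (by positivity)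
      have hkt' : 1 / t < (k : ℝ) + 1 := Nat.lt_floor_add_one _
      have hkk : k₀ ≤ k := by
        refine Nat.le_floor ?_
        rw [le_div_iff₀ (by positivity)] at h
        rw [le_div_iff₀ ht]
        linarith
      have hkp : (0 : ℝ) < k := by exact_mod_cast lt_of_lt_of_le hk₀ hkk
      have h1 : envelope B t ≤ g (k - k₀) t := by
        simp only [g, Nat.sub_add_cancel hkk]
        refine (hk k hkk).2.2.1 t ?_ ?_
        · rw [div_le_iff₀ (by positivity)]
          rw [div_lt_iff₀ ht] at hkt'
          linarith
        · rw [le_div_iff₀ ht] at hkt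
          rw [le_div_iff₀ hkp]
          linarith
      have ht1 : t ≤ 1 := h.trans (by rw [div_le_one (by positivity)]; exact hk₀')
      calc ENNReal.ofReal (envelope B t * Real.exp t)
          ≤ ENNReal.ofReal (Real.exp 1 * g (k - k₀) t) := by
            refine ENNReal.ofReal_le_ofReal ?_
            rw [mul_comm]
            gcongr
            exact envelope_nonneg hB t
        _ = ENNReal.ofReal (Real.exp 1) * ENNReal.ofReal (g (k - k₀) t) :=
            ENNReal.ofReal_mul (Real.exp_pos 1).le
        _ ≤ _ := by
            gcongr
            exact ENNReal.le_tsum (f := fun k => ENNReal.ofReal (g k t)) (k - k₀)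
  refine lt_of_le_of_lt (lintegral_mono_ae hle) ?_
  rw [lintegral_add_left (by fun_prop), lintegral_const_mul _ (Measurable.tsum fun k => by fun_prop)]
  refine ENNReal.add_lt_top.mpr ⟨?_, ENNReal.mul_lt_top ENNReal.ofReal_lt_top hgfin.lt_top⟩
  have := (hexp.const_mul D).2
  rwa [hasFiniteIntegral_iff_ofReal (ae_of_all _ fun t => by positivity)] at this

end

/-! ### Heat kernels as test functions, and growth of the heat extension. -/

section

/-- The heat kernel at time `t`, centred at `x`, as an entire function. -/
def heat (t x : ℝ) (z : ℂ) : ℂ :=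
  ((Real.sqrt (4 * Real.pi * t))⁻¹ : ℝ) * Complex.exp (-(z - x) ^ 2 / (4 * t : ℝ))

theorem differentiable_heat (t x : ℝ) : Differentiable ℂ (heat t x) := by
  unfold heat
  fun_prop

theorem norm_heat_le {t : ℝ} (ht : 0 < t) (x : ℝ) {κ : ℝ} (hκ : 0 ≤ κ) {d : ℝ} {z : ℂ}
    (hz : |z.im| ≤ d) :
    ‖heat t x z‖ ≤ (Real.sqrt (4 * Real.pi * t))⁻¹ * Real.exp (d ^ 2 / (4 * t)) *
      Real.exp (κ ^ 2 * t) * Real.exp (κ * |x|) * Real.exp (-κ * |z.re|) := by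
  rw [heat, norm_mul, Complex.norm_real, Real.norm_of_nonneg (by positivity), Complex.norm_exp]
  simp only [mul_assoc]
  gcongr
  rw [← Real.exp_add, ← Real.exp_add, ← Real.exp_add]
  refine Real.exp_le_exp.mpr ?_
  have h1 : (-(z - x) ^ 2 / ((4 * t : ℝ) : ℂ)).re = (z.im ^ 2 - (z.re - x) ^ 2) / (4 * t) := by
    rw [Complex.div_ofReal_re]
    congr 1
    simp [pow_two]
  have h2 : z.im ^ 2 ≤ d ^ 2 := by
    rw [← sq_abs]
    gcongr
  have h3 : |z.re| ≤ |z.re - x| + |x| := by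
    have := abs_add_le (z.re - x) x
    simpa using this
  -- Completing the square trades Gaussian decay for exponential decay at any rate κ.
  have h4 : κ * |z.re - x| - (z.re - x) ^ 2 / (4 * t) ≤ κ ^ 2 * t := by
    rw [sub_le_iff_le_add, ← sub_le_iff_le_add', le_div_iff₀ (by positivity), ← sq_abs (z.re - x)]
    nlinarith [sq_nonneg (|z.re - x| - 2 * κ * t)]
  rw [h1, sub_div]
  have h5 : z.im ^ 2 / (4 * t) ≤ d ^ 2 / (4 * t) := by gcongr
  nlinarith [mul_le_mul_of_nonneg_left h3 hκ]

theorem abs_im_le_of_mem_strip {ν : ℝ} {z : ℂ} (hz : z ∈ strip ν) : |z.im| ≤ 1 / ν :=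
  abs_le.mpr ⟨hz.1.le, hz.2.le⟩

theorem isBoundedHolo_heat (n : ℕ+) {t : ℝ} (ht : 0 < t) (x : ℝ) : IsBoundedHolo n (heat t x) := by
  have hn : (0 : ℝ) < n := by exact_mod_cast n.pos
  refine ⟨(differentiable_heat t x).differentiableOn, (Real.sqrt (4 * Real.pi * t))⁻¹ *
    Real.exp ((1 / n) ^ 2 / (4 * t)) * Real.exp ((1 / n) ^ 2 * t) * Real.exp (1 / n * |x|),
    fun z hz => ?_⟩
  have h := norm_heat_le ht x (κ := 1 / n) (by positivity) (abs_im_le_of_mem_strip hz)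
  rwa [neg_mul, one_div_mul_eq_div (n : ℝ) |z.re|] at h

/-- With y = 1/(n²t), the growth of the Gaussian off the real axis costs at most e^y and the
prefactor (4πt)^{-1/2} at most n e^y; hence the 2 in the exponent. -/
theorem norm_ofHolo_heat_le (n : ℕ+) {t : ℝ} (ht : 0 < t) (x : ℝ) :
    ‖ofHolo n (heat t x)‖ ≤
      n * Real.exp (2 / ((n : ℝ) ^ 2 * t)) * Real.exp t * Real.exp (|x| / n) := by
  have hn : (1 : ℝ) ≤ n := by exact_mod_cast n.pos
  have hn0 : (0 : ℝ) < n := by linarith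
  let y := 1 / ((n : ℝ) ^ 2 * t)
  have hy : 0 < y := by positivity
  have hny : (n : ℝ) ^ 2 * t * y = 1 := mul_one_div_cancel (by positivity)
  have h1 : (Real.sqrt (4 * Real.pi * t))⁻¹ ≤ n * Real.exp y := by
    have h2 : (1 + y) ≤ Real.exp y := by linarith [Real.add_one_le_exp y]
    refine le_trans ?_ (mul_le_mul_of_nonneg_left h2 hn0.le)
    refine inv_le_of_inv_le₀ (by positivity) (Real.le_sqrt_of_sq_le ?_)
    rw [inv_pow, inv_le_iff_one_le_mul₀ (by positivity)]
    calc (1 : ℝ) = (n : ℝ) ^ 2 * t * y := hny.symm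
      _ ≤ (n : ℝ) ^ 2 * t * ((4 * Real.pi) * (1 + y) ^ 2) := by
          gcongr
          nlinarith [Real.pi_gt_three]
      _ = _ := by ring
  refine norm_ofHolo_le (by positivity) fun z hz =>
    (norm_heat_le ht x (κ := 1 / n) (by positivity) (abs_im_le_of_mem_strip hz)).trans ?_
  have h3 : -(1 / (n : ℝ)) * |z.re| = -(|z.re| / n) := by ring
  have h4 : (1 / (n : ℝ)) * |x| = |x| / n := by ring
  have h5 : Real.exp (2 / ((n : ℝ) ^ 2 * t)) = Real.exp y * Real.exp y := by
    rw [← Real.exp_add]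
    congr 1
    simp only [y]
    ring
  have h6 : (1 / (n : ℝ)) ^ 2 / (4 * t) ≤ y := by
    have : (1 / (n : ℝ)) ^ 2 / (4 * t) = y / 4 := by
      simp only [y]
      field_simp
    linarith
  have h7 : (1 / (n : ℝ)) ^ 2 * t ≤ t := by
    refine mul_le_of_le_one_left ht.le (pow_le_one₀ (by positivity) ?_)
    exact div_le_one_of_le₀ hn hn0.le
  rw [h3, h4, h5]
  gcongr ?_ * _ * _
  calc _ ≤ n * Real.exp y * Real.exp y * Real.exp t := by gcongr
    _ = _ := by ring

theorem continuousAt_ofHolo_heat (n : ℕ+) {p₀ : ℝ × ℝ} (ht : 0 < p₀.1) :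
    ContinuousAt (fun p : ℝ × ℝ => ofHolo n (heat p.1 p.2)) p₀ := by
  have hn : (0 : ℝ) < n := by exact_mod_cast n.pos
  have hs : Real.sqrt (4 * Real.pi * p₀.1) ≠ 0 := by positivity
  have h4 : 4 * p₀.1 ≠ 0 := by positivity
  have hpos : ∀ᶠ p : ℝ × ℝ in 𝓝 p₀, 0 < p.1 := continuousAt_fst.eventually_const_lt ht
  -- The decay rate κ = 2/n is taken, twice what is needed, which leaves δ = 1/n to spare.
  refine continuousAt_ofHolo (δ := 1 / n)
    (K := fun p => (Real.sqrt (4 * Real.pi * p.1))⁻¹ * Real.exp ((1 / n) ^ 2 / (4 * p.1)) *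
      Real.exp ((1 / n + 1 / n) ^ 2 * p.1) * Real.exp ((1 / n + 1 / n) * |p.2|)) (by positivity) ?_
      (fun z hz => ?_) (Eventually.of_forall fun p => (differentiable_heat _ _).differentiableOn) ?_
  · fun_prop (disch := assumption)
  · have h5 : ((4 * p₀.1 : ℝ) : ℂ) ≠ 0 := by exact_mod_cast h4
    unfold heat
    refine ContinuousAt.mul (Complex.continuous_ofReal.continuousAt.comp ?_)
      (Complex.continuous_exp.continuousAt.comp (ContinuousAt.div ?_ ?_ h5))
    · fun_prop (disch := assumption)
    · fun_prop
    · fun_prop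
  · filter_upwards [hpos] with p hp z hz
    exact norm_heat_le hp _ (by positivity) (abs_im_le_of_mem_strip hz)

variable {X : Type*} [NormedAddCommGroup X] [NormedSpace ℂ X] {a : ℝ}

/-- The smoothing of `G ∈ 𝒬_a` by the heat kernel at time `t`. -/
def Q.heatExtension (G : Q a X) (t x : ℝ) : X := G.restrict 1 (ofHolo 1 (heat t x))

theorem Q.heatExtension_eq (G : Q a X) (n : ℕ+) {t : ℝ} (ht : 0 < t) (x : ℝ) :
    G.heatExtension t x = G.restrict n (ofHolo n (heat t x)) :=
  G.restrict_congr fun y => by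
    rw [realEval_ofHolo (isBoundedHolo_heat _ ht x), realEval_ofHolo (isBoundedHolo_heat _ ht x)]

theorem Q.continuousAt_heatExtension (G : Q a X) {p₀ : ℝ × ℝ} (ht : 0 < p₀.1) :
    ContinuousAt (fun p : ℝ × ℝ => G.heatExtension p.1 p.2) p₀ :=
  (G.restrict 1).continuous.continuousAt.comp (continuousAt_ofHolo_heat 1 ht)

/-- For each pair (q, N) the bound from the strip of index max(q, N) is used: its growth in x is at
most e^{|x|/(N+1)}, its singularity in t at most e^{2/((q+1)²t)}, and its constant at most B_q B_N
since both are at least 1. The infimum over q produces the envelope. -/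
theorem Q.exists_heatExtension_le (G : Q a X) :
    ∃ B : ℕ → ℝ, (∀ q, 1 ≤ B q) ∧ ∀ t : ℝ, 0 < t → ∀ (x : ℝ) (N : ℕ),
      ‖G.heatExtension t x‖ ≤ B N * (envelope B t * Real.exp t) * Real.exp (|x| / (N + 1)) := by
  let B : ℕ → ℝ := fun q => max 1 (‖G.restrict q.succPNat‖ * (q + 1))
  have hB : ∀ q, 1 ≤ B q := fun q => le_max_left _ _
  refine ⟨B, hB, fun t ht x N => ?_⟩
  have hq : ∀ q : ℕ, ‖G.heatExtension t x‖ ≤ B q * Real.exp (2 / (((q : ℝ) + 1) ^ 2 * t)) *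
      Real.exp t * Real.exp (|x| / (q + 1)) := by
    intro q
    rw [G.heatExtension_eq q.succPNat ht x]
    refine ((G.restrict q.succPNat).le_opNorm _).trans ?_
    refine (mul_le_mul_of_nonneg_left (norm_ofHolo_heat_le _ ht x)
      (norm_nonneg (G.restrict q.succPNat))).trans ?_
    have hc : ((q.succPNat : ℕ+) : ℝ) = q + 1 := by simp
    rw [hc, ← mul_assoc, ← mul_assoc, ← mul_assoc]
    gcongr
    exact le_max_right _ _
  have key : ∀ q : ℕ, ‖G.heatExtension t x‖ ≤ B N * Real.exp t * Real.exp (|x| / (N + 1)) *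
      (B q * Real.exp (2 / (((q : ℝ) + 1) ^ 2 * t))) := by
    intro q
    have h1 := hB q
    have h2 := hB N
    rcases le_total N q with h | h
    · have h' : (N : ℝ) ≤ q := by exact_mod_cast h
      calc _ ≤ _ := hq q
        _ ≤ B q * Real.exp (2 / (((q : ℝ) + 1) ^ 2 * t)) * Real.exp t *
            Real.exp (|x| / (N + 1)) := by gcongr
        _ ≤ B N * (B q * Real.exp (2 / (((q : ℝ) + 1) ^ 2 * t)) * Real.exp t *
            Real.exp (|x| / (N + 1))) := le_mul_of_one_le_left (by positivity) h2
        _ = _ := by ring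
    · have h' : (q : ℝ) ≤ N := by exact_mod_cast h
      calc _ ≤ _ := hq N
        _ ≤ B N * Real.exp (2 / (((q : ℝ) + 1) ^ 2 * t)) * Real.exp t *
            Real.exp (|x| / (N + 1)) := by gcongr
        _ ≤ B q * (B N * Real.exp (2 / (((q : ℝ) + 1) ^ 2 * t)) * Real.exp t *
            Real.exp (|x| / (N + 1))) := le_mul_of_one_le_left (by positivity) h1
        _ = _ := by ring
  have hN := hB N
  have hpos : 0 < B N * Real.exp t * Real.exp (|x| / (N + 1)) := by positivity
  calc ‖G.heatExtension t x‖
      = B N * Real.exp t * Real.exp (|x| / (N + 1)) *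
        (‖G.heatExtension t x‖ / (B N * Real.exp t * Real.exp (|x| / (N + 1)))) :=
        (mul_div_cancel₀ _ hpos.ne').symm
    _ ≤ B N * Real.exp t * Real.exp (|x| / (N + 1)) * envelope B t := by
        gcongr
        exact le_ciInf fun q => (div_le_iff₀' hpos).mpr (key q)
    _ = _ := by ring

end

/-! ### Infinite products of exponential type zero and their Taylor coefficients. -/

section

/-- Euler's sine product at iy reads sinh(πy) = πy ∏ (1 + y²/j²), with increasing partial products.
For y ≥ 1 the factor πy is at least 1 and can be dropped; y ≤ 1 is compared with y = 1, which
accounts for e^π. -/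
theorem prod_one_add_sq_div_le {y : ℝ} (hy : 0 ≤ y) (n : ℕ) :
    ∏ j ∈ Finset.range n, (1 + y ^ 2 / ((j : ℝ) + 1) ^ 2) ≤
      Real.exp Real.pi * Real.exp (Real.pi * y) := by
  have key : ∀ y : ℝ, 1 ≤ y →
      ∏ j ∈ Finset.range n, (1 + y ^ 2 / ((j : ℝ) + 1) ^ 2) ≤ Real.exp (Real.pi * y) := by
    intro y hy
    have h := (Complex.tendsto_euler_sin_prod ((y : ℂ) * Complex.I)).norm
    have h1 : ∀ n : ℕ, ‖(Real.pi : ℂ) * (y * Complex.I) *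
        ∏ j ∈ Finset.range n, (1 - ((y : ℂ) * Complex.I) ^ 2 / ((j : ℂ) + 1) ^ 2)‖ =
        Real.pi * y * ∏ j ∈ Finset.range n, (1 + y ^ 2 / ((j : ℝ) + 1) ^ 2) := by
      intro n
      have h2 : ∀ j : ℕ, (1 - ((y : ℂ) * Complex.I) ^ 2 / ((j : ℂ) + 1) ^ 2) =
          ((1 + y ^ 2 / ((j : ℝ) + 1) ^ 2 : ℝ) : ℂ) := by
        intro j
        push_cast
        rw [mul_pow, Complex.I_sq]
        ring
      simp_rw [h2]
      rw [← Complex.ofReal_prod, norm_mul, norm_mul, norm_mul, Complex.norm_I, Complex.norm_real,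
        Complex.norm_real, Complex.norm_real, Real.norm_of_nonneg Real.pi_pos.le,
        Real.norm_of_nonneg (by linarith), Real.norm_of_nonneg
        (Finset.prod_nonneg fun j _ => by positivity), mul_one]
    simp_rw [h1] at h
    have h3 : ‖Complex.sin (Real.pi * (y * Complex.I))‖ ≤ Real.exp (Real.pi * y) := by
      rw [← mul_assoc, Complex.sin_mul_I, norm_mul, Complex.norm_I, mul_one, ← Complex.ofReal_mul,
        ← Complex.ofReal_sinh, Complex.norm_real, Real.norm_of_nonneg
        (Real.sinh_nonneg_iff.mpr (by positivity)), Real.sinh_eq]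
      linarith [Real.exp_pos (Real.pi * y), Real.exp_pos (-(Real.pi * y))]
    have hp : ∀ n, 0 ≤ ∏ j ∈ Finset.range n, (1 + y ^ 2 / ((j : ℝ) + 1) ^ 2) := fun n =>
      Finset.prod_nonneg fun j _ => by positivity
    have hmono : Monotone fun n => Real.pi * y *
        ∏ j ∈ Finset.range n, (1 + y ^ 2 / ((j : ℝ) + 1) ^ 2) := by
      refine monotone_nat_of_le_succ fun n => ?_
      rw [Finset.prod_range_succ]
      gcongr
      refine le_mul_of_one_le_right (hp n) ?_
      have : 0 ≤ y ^ 2 / ((n : ℝ) + 1) ^ 2 := by positivity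
      linarith
    refine le_trans (le_mul_of_one_le_left (hp n) ?_) ((hmono.ge_of_tendsto h n).trans h3)
    nlinarith [Real.pi_gt_three]
  rcases le_total 1 y with h | h
  · refine (key y h).trans (le_mul_of_one_le_left (Real.exp_pos _).le ?_)
    exact Real.one_le_exp Real.pi_pos.le
  · calc _ ≤ ∏ j ∈ Finset.range n, (1 + (1 : ℝ) ^ 2 / ((j : ℝ) + 1) ^ 2) := by gcongr
      _ ≤ Real.exp (Real.pi * 1) := key 1 le_rfl
      _ ≤ _ := by
        rw [mul_one]
        exact le_mul_of_one_le_right (Real.exp_pos _).le (Real.one_le_exp (by positivity))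

theorem one_add_mul_sq_le_exp {c η x : ℝ} (hc : 0 ≤ c) (hη : 0 < η) (hx : 0 ≤ x) :
    1 + c * x ^ 2 ≤ (1 + 2 * c / η ^ 2) * Real.exp (η * x) := by
  have h1 := Real.quadratic_le_exp_of_nonneg (mul_nonneg hη.le hx)
  have h2 : (η * x) ^ 2 / 2 ≤ Real.exp (η * x) := by nlinarith [mul_nonneg hη.le hx]
  have h3 : 1 ≤ Real.exp (η * x) := Real.one_le_exp (by positivity)
  have h4 : c * x ^ 2 = 2 * c / η ^ 2 * ((η * x) ^ 2 / 2) := by field_simp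
  rw [add_mul, one_mul, h4]
  gcongr

/-- Infinite products with coefficients `c_j = o(j^{-2})` are of exponential type zero. -/
theorem prod_one_add_mul_sq_le {c : ℕ → ℝ} (hc0 : ∀ j, 0 < c j)
    (hc : Tendsto (fun j : ℕ => c j * ((j : ℝ) + 1) ^ 2) atTop (𝓝 0)) {ε : ℝ} (hε : 0 < ε) :
    ∃ C : ℝ, 0 ≤ C ∧ ∀ x : ℝ, 0 ≤ x → ∀ n : ℕ,
      ∏ j ∈ Finset.range n, (1 + c j * x ^ 2) ≤ C * Real.exp (ε * x) := by
  -- Half of ε is spent on the tail, where c_j ≤ δ²/(j+1)² and πδ = ε/2, and half on the first J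
  -- factors.
  let δ := ε / (2 * Real.pi)
  have hδ : 0 < δ := by positivity
  obtain ⟨J, hJ⟩ := eventually_atTop.mp (hc.eventually_le_const (show (0 : ℝ) < δ ^ 2 by positivity))
  -- Dividing by J + 1 instead of J covers J = 0.
  let η := ε / 2 / (J + 1)
  have hη : 0 < η := by positivity
  let K := ∏ j ∈ Finset.range J, (1 + 2 * c j / η ^ 2)
  have hK : 0 ≤ K := Finset.prod_nonneg fun j _ => by have := hc0 j; positivity
  refine ⟨K * Real.exp Real.pi, by positivity, fun x hx n => ?_⟩
  have h0 : ∀ j, 0 ≤ c j * x ^ 2 := fun j => by have := hc0 j; positivity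
  have h1 : ∏ j ∈ Finset.range J, (1 + c j * x ^ 2) ≤ K * Real.exp (ε / 2 * x) := by
    calc ∏ j ∈ Finset.range J, (1 + c j * x ^ 2)
        ≤ ∏ j ∈ Finset.range J, ((1 + 2 * c j / η ^ 2) * Real.exp (η * x)) :=
          Finset.prod_le_prod (fun j _ => by linarith [h0 j]) fun j _ =>
            one_add_mul_sq_le_exp (hc0 j).le hη hx
      _ = K * Real.exp (J * (η * x)) := by
          rw [Finset.prod_mul_distrib, Finset.prod_const, Finset.card_range, ← Real.exp_nat_mul]
      _ ≤ _ := by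
          rw [← mul_assoc]
          gcongr
          simp only [η]
          rw [mul_div_assoc', div_le_iff₀ (by positivity)]
          nlinarith
  have h2 : ∏ j ∈ Finset.range n, (1 + c j * x ^ 2) ≤
      (∏ j ∈ Finset.range J, (1 + c j * x ^ 2)) *
        ∏ j ∈ Finset.range n, (1 + (δ * x) ^ 2 / ((j : ℝ) + 1) ^ 2) := by
    rw [← Finset.prod_filter_mul_prod_filter_not (Finset.range n) (fun j => j < J)]
    have h3 : ∀ j, (0 : ℝ) ≤ (δ * x) ^ 2 / ((j : ℝ) + 1) ^ 2 := fun j => by positivity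
    refine mul_le_mul ?_ ?_ (Finset.prod_nonneg fun j _ => by linarith [h0 j])
      (Finset.prod_nonneg fun j _ => by linarith [h0 j])
    · refine Finset.prod_le_prod_of_subset_of_one_le (fun j hj => ?_)
        (fun j _ => by linarith [h0 j]) fun j _ _ => by linarith [h0 j]
      exact Finset.mem_range.mpr (Finset.mem_filter.mp hj).2
    · refine (Finset.prod_le_prod (fun j _ => by linarith [h0 j]) fun j hj => ?_).trans
        (Finset.prod_le_prod_of_subset_of_one_le (Finset.filter_subset _ _)
          (fun j _ => by positivity) fun j _ _ => by linarith [h3 j])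
      have h4 := hJ j (not_lt.mp (Finset.mem_filter.mp hj).2)
      rw [add_le_add_iff_left, le_div_iff₀ (by positivity)]
      calc c j * x ^ 2 * ((j : ℝ) + 1) ^ 2 = c j * ((j : ℝ) + 1) ^ 2 * x ^ 2 := by ring
        _ ≤ δ ^ 2 * x ^ 2 := by gcongr
        _ = _ := by ring
  calc _ ≤ _ := h2
    _ ≤ (K * Real.exp (ε / 2 * x)) * (Real.exp Real.pi * Real.exp (Real.pi * (δ * x))) := by
        gcongr
        exact prod_one_add_sq_div_le (by positivity) n
    _ = K * Real.exp Real.pi * Real.exp (ε * x) := by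
        have : Real.pi * (δ * x) = ε / 2 * x := by
          simp only [δ]
          field_simp
        rw [this, show ε * x = ε / 2 * x + ε / 2 * x by ring, Real.exp_add]
        ring

/-- The entire function `∏ (1 - c_j ζ²)`. -/
theorem exists_entire_product {c : ℕ → ℝ} (hc0 : ∀ j, 0 < c j) (hcs : Summable c)
    (hc : Tendsto (fun j : ℕ => c j * ((j : ℝ) + 1) ^ 2) atTop (𝓝 0)) :
    ∃ f : ℂ → ℂ, Differentiable ℂ f ∧
      (∀ ζ, Tendsto (fun n => ∏ j ∈ Finset.range n, (1 - (c j : ℂ) * ζ ^ 2)) atTop (𝓝 (f ζ))) ∧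
      ∀ ε : ℝ, 0 < ε → ∃ C : ℝ, 0 ≤ C ∧ ∀ ζ, ‖f ζ‖ ≤ C * Real.exp (ε * ‖ζ‖) := by
  have hloc : ∀ R : ℝ, TendstoLocallyUniformlyOn
      (fun n ζ => ∏ j ∈ Finset.range n, (1 + -((c j : ℂ) * ζ ^ 2)))
      (fun ζ => ∏' j, (1 + -((c j : ℂ) * ζ ^ 2))) atTop (Metric.ball 0 R) := by
    intro R
    refine (Summable.hasProdLocallyUniformlyOn_nat_one_add (K := Metric.ball (0 : ℂ) R)
      (f := fun j ζ => -((c j : ℂ) * ζ ^ 2)) Metric.isOpen_ball (hcs.mul_right (R ^ 2))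
      (Eventually.of_forall fun j ζ hζ => ?_)
      fun j => by fun_prop).tendstoLocallyUniformlyOn_finsetRange
    rw [norm_neg, norm_mul, norm_pow, Complex.norm_real, Real.norm_of_nonneg (hc0 j).le]
    have := hc0 j
    gcongr
    simpa using (mem_ball_zero_iff.mp hζ).le
  have hlim : ∀ ζ, Tendsto (fun n => ∏ j ∈ Finset.range n, (1 + -((c j : ℂ) * ζ ^ 2))) atTop
      (𝓝 (∏' j, (1 + -((c j : ℂ) * ζ ^ 2)))) := fun ζ =>
    (hloc (‖ζ‖ + 1)).tendsto_at (by simp)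
  refine ⟨fun ζ => ∏' j, (1 + -((c j : ℂ) * ζ ^ 2)), fun ζ => ?_, fun ζ => ?_, fun ε hε => ?_⟩
  · refine ((hloc (‖ζ‖ + 1)).differentiableOn (Eventually.of_forall fun n => ?_)
      Metric.isOpen_ball).differentiableAt (Metric.isOpen_ball.mem_nhds (by simp))
    fun_prop
  · simpa only [sub_eq_add_neg] using hlim ζ
  · obtain ⟨C, hC0, hC⟩ := prod_one_add_mul_sq_le hc0 hc hε
    refine ⟨C, hC0, fun ζ => le_of_tendsto' (hlim ζ).norm fun n => ?_⟩
    refine le_trans ?_ (hC ‖ζ‖ (norm_nonneg _) n)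
    rw [norm_prod]
    refine Finset.prod_le_prod (fun _ _ => norm_nonneg _) fun j _ => (norm_add_le _ _).trans ?_
    rw [norm_neg, norm_mul, norm_pow, Complex.norm_real, Real.norm_of_nonneg (hc0 j).le, norm_one]

/-- Taylor coefficients of entire functions of exponential type zero. -/
theorem exists_taylor_coefficients {f : ℂ → ℂ} (hf : Differentiable ℂ f)
    (hg : ∀ ε : ℝ, 0 < ε → ∃ C : ℝ, 0 ≤ C ∧ ∀ ζ, ‖f ζ‖ ≤ C * Real.exp (ε * ‖ζ‖)) :
    ∃ b : ℕ → ℂ, (∀ ζ, HasSum (fun k => b k * ζ ^ k) (f ζ)) ∧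
      ∀ ε : ℝ, 0 < ε → ∃ C : ℝ, 0 ≤ C ∧ ∀ k, ‖b k‖ * (k.factorial : ℝ) ≤ C * ε ^ k := by
  refine ⟨fun k => (k.factorial : ℂ)⁻¹ * iteratedDeriv k f 0, fun ζ => ?_, fun ε hε => ?_⟩
  · refine (Complex.hasSum_taylorSeries_of_entire hf 0 ζ).congr_fun ?_
    intro k
    simp only [sub_zero, smul_eq_mul]
    ring
  -- Cauchy's estimate on the circle of radius (k+1)/η: k! ≤ (k+1)^k cancels the radius, and e^{k+1}
  -- η^k = e ε^k. Taking k+1 keeps the radius positive for k = 0.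
  · let η := ε / Real.exp 1
    have hη : 0 < η := by positivity
    obtain ⟨C, hC0, hC⟩ := hg η hη
    refine ⟨C * Real.exp 1, by positivity, fun k => ?_⟩
    have hR : 0 < ((k : ℝ) + 1) / η := by positivity
    have h := Complex.norm_iteratedDeriv_le_of_forall_mem_sphere_norm_le (f := f) (c := 0) k hR
      hf.diffContOnCl (C := C * Real.exp (k + 1)) (fun z hz => by
        refine (hC z).trans (le_of_eq ?_)
        rw [mem_sphere_zero_iff_norm.mp hz, mul_div_cancel₀ _ hη.ne'])
    have hfac : (k.factorial : ℝ) ≤ ((k : ℝ) + 1) ^ k := by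
      calc (k.factorial : ℝ) ≤ (k : ℝ) ^ k := by exact_mod_cast Nat.factorial_le_pow k
        _ ≤ _ := by gcongr; linarith
    have hk : (0 : ℝ) < k.factorial := by positivity
    rw [norm_mul, norm_inv, Complex.norm_natCast, mul_comm, ← mul_assoc, mul_inv_cancel₀ hk.ne',
      one_mul]
    refine h.trans ?_
    rw [div_pow, div_div_eq_mul_div, div_le_iff₀ (by positivity)]
    calc (k.factorial : ℝ) * (C * Real.exp (k + 1)) * η ^ k
        ≤ ((k : ℝ) + 1) ^ k * (C * Real.exp (k + 1)) * η ^ k := by gcongr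
      _ = C * Real.exp 1 * ε ^ k * ((k : ℝ) + 1) ^ k := by
          have h1 : ε ^ k = η ^ k * Real.exp k := by
            rw [show (k : ℝ) = k * 1 by ring, Real.exp_nat_mul, ← mul_pow]
            congr 1
            simp only [η]
            field_simp
          rw [h1, Real.exp_add]
          ring

theorem isLocalOperator_of_bound {b : ℕ → ℂ}
    (hb : ∀ ε : ℝ, 0 < ε → ∃ C : ℝ, 0 ≤ C ∧ ∀ k, ‖b k‖ * (k.factorial : ℝ) ≤ C * ε ^ k) :
    IsLocalOperator b := by
  refine tendsto_order.mpr ⟨fun u hu => Eventually.of_forall fun k => lt_of_lt_of_le hu (by positivity),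
    fun u hu => ?_⟩
  obtain ⟨C, hC0, hC⟩ := hb (u / 2) (by positivity)
  -- `C` may be 0, hence `C + 1`.
  have h1 : Tendsto (fun k : ℕ => (C + 1) ^ (1 / (k : ℝ))) atTop (𝓝 1) := by
    have := (tendsto_const_nhds (x := C + 1)).rpow (tendsto_one_div_atTop_nhds_zero_nat (𝕜 := ℝ))
      (Or.inl (by positivity))
    simpa using this
  filter_upwards [h1.eventually_lt_const (show (1 : ℝ) < 2 by norm_num), eventually_gt_atTop 0]
    with k hk hk0
  have hk' : (k : ℝ) ≠ 0 := by exact_mod_cast hk0.ne'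
  calc (‖b k‖ * (k.factorial : ℝ)) ^ (1 / (k : ℝ)) ≤ ((C + 1) * (u / 2) ^ k) ^ (1 / (k : ℝ)) := by
        refine Real.rpow_le_rpow (by positivity) ((hC k).trans ?_) (by positivity)
        gcongr
        linarith
    _ = (C + 1) ^ (1 / (k : ℝ)) * (u / 2) := by
        rw [Real.mul_rpow (by positivity) (by positivity), ← Real.rpow_natCast (u / 2),
          ← Real.rpow_mul (by positivity), mul_one_div_cancel hk', Real.rpow_one]
    _ < 2 * (u / 2) := by gcongr
    _ = u := by ring

end

/-! ### Derivatives of test functions on a smaller strip. -/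

section

/-- The functions `e^{a·} φ^{(k)}` extend to holomorphic functions on a common strip, with Cauchy
estimates. -/
theorem WeightedRapid.exists_iteratedDeriv_extension {a : ℝ} (φ : WeightedRapid a) :
    ∃ (n : ℕ+) (δ r C : ℝ) (ψ : ℕ → ℂ → ℂ), 0 < δ ∧ 0 < r ∧ 0 ≤ C ∧
      (∀ k (z : ℂ), |z.im| ≤ 1 / n → DifferentiableAt ℂ (ψ k) z) ∧
      (∀ k (z : ℂ), |z.im| ≤ 1 / n →
        ‖ψ k z‖ ≤ C * (k.factorial / r ^ k) * Real.exp (-(1 / n + δ) * |z.re|)) ∧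
      ∀ k (x : ℝ), ψ k x = (Real.exp (a * x) : ℂ) * iteratedDeriv k φ x := by
  obtain ⟨m, F, ⟨hF, -, hFb⟩, hφF⟩ := φ.2.2
  have hm : (0 : ℝ) < m := by exact_mod_cast m.pos
  -- The given strip has half-width and decay rate 4η. The new strip, of index 2m, has half-width
  -- 2η, so Cauchy discs of radius η stay within 3η. Losing η of decay leaves 3η = 1/(2m) + η, hence
  -- δ = η.
  let η : ℝ := 1 / (4 * m)
  have hη : 0 < η := by positivity
  have hmη : 1 / (m : ℝ) = 4 * η := by simp only [η]; field_simp
  obtain ⟨C₀, hC₀⟩ := hFb (Set.Icc (-(3 * η)) (3 * η)) isCompact_Icc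
    (fun y hy => ⟨by linarith [hy.1], by linarith [hy.2]⟩) η hη
  have hC₀0 : 0 ≤ C₀ := by
    have h := (norm_nonneg _).trans (hC₀ 0 ⟨by simp; linarith, by simp; linarith⟩)
    exact nonneg_of_mul_nonneg_left h (Real.exp_pos _)
  let Φ : ℂ → ℂ := fun z => Complex.exp (-(a * z)) * F z
  have hΦ : DifferentiableOn ℂ Φ (strip (m : ℝ)) :=
    (by fun_prop : Differentiable ℂ fun z : ℂ => Complex.exp (-(a * z))).differentiableOn.mul hF
  have hΦk : ∀ k, DifferentiableOn ℂ (iteratedDeriv k Φ) (strip (m : ℝ)) := by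
    intro k
    rw [iteratedDeriv_eq_iterate]
    exact ((hΦ.analyticOnNhd (isOpen_strip _)).iterated_deriv k).differentiableOn
  have hΦat : ∀ k, ∀ z ∈ strip (m : ℝ), DifferentiableAt ℂ (iteratedDeriv k Φ) z := fun k z hz =>
    (hΦk k).differentiableAt ((isOpen_strip _).mem_nhds hz)
  have hreal : ∀ k, iteratedDeriv k φ = fun x : ℝ => iteratedDeriv k Φ x := by
    intro k
    induction k with
    | zero =>
      funext x
      have h := hφF x
      simp only [iteratedDeriv_zero, Φ]
      rw [← h, ← mul_assoc, Complex.ofReal_exp, ← Complex.exp_add]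
      simp
    | succ k ih =>
      funext x
      rw [iteratedDeriv_succ, ih, iteratedDeriv_succ]
      exact (hΦat k x (ofReal_mem_strip m x)).hasDerivAt.comp_ofReal.deriv
  have hn : 1 / ((2 * m : ℕ+) : ℝ) = 2 * η := by
    push_cast
    simp only [η]
    field_simp
    norm_num
  have hstrip : ∀ z : ℂ, |z.im| ≤ 3 * η → z ∈ strip (m : ℝ) := fun z hz =>
    ⟨by linarith [(abs_le.mp hz).1], by linarith [(abs_le.mp hz).2]⟩
  refine ⟨2 * m, η, η, Real.exp (|a| * η) * C₀ * Real.exp (3 * η * η),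
    fun k z => Complex.exp (a * z) * iteratedDeriv k Φ z, hη, hη, by positivity,
    fun k z hz => ?_, fun k z hz => ?_, fun k x => ?_⟩
  · rw [hn] at hz
    exact (by fun_prop : DifferentiableAt ℂ (fun z : ℂ => Complex.exp (a * z)) z).mul
      (hΦat k z (hstrip z (by linarith)))
  · rw [hn] at hz
    have hball : ∀ w ∈ Metric.closedBall z η, |w.im| ≤ 3 * η ∧ |w.re - z.re| ≤ η := by
      intro w hw
      rw [Metric.mem_closedBall, dist_eq_norm] at hw
      have h1 := (Complex.abs_im_le_norm (w - z)).trans hw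
      have h2 := (Complex.abs_re_le_norm (w - z)).trans hw
      rw [Complex.sub_im] at h1
      rw [Complex.sub_re] at h2
      refine ⟨?_, h2⟩
      have h3 := abs_add_le (w.im - z.im) z.im
      rw [sub_add_cancel] at h3
      linarith
    have hcl : DiffContOnCl ℂ Φ (Metric.ball z η) := by
      refine DifferentiableOn.diffContOnCl ?_
      rw [closure_ball _ hη.ne']
      exact hΦ.mono fun w hw => hstrip w (hball w hw).1
    have h := Complex.norm_iteratedDeriv_le_of_forall_mem_sphere_norm_le (f := Φ) (c := z) k hη hcl
      (C := Real.exp (-(a * z.re)) * (Real.exp (|a| * η) * C₀ * Real.exp (3 * η * η) *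
        Real.exp (-(2 * η + η) * |z.re|))) (fun w hw => by
        obtain ⟨h1, h2⟩ := hball w (Metric.sphere_subset_closedBall hw)
        have h3 := hC₀ w (abs_le.mp h1)
        rw [norm_mul, Complex.norm_exp]
        refine (mul_le_mul_of_nonneg_left h3 (Real.exp_pos _).le).trans ?_
        have h4 : (-((a : ℂ) * w)).re = -(a * w.re) := by simp
        rw [h4]
        have h5 : |z.re| ≤ |w.re| + η := by
          have := abs_sub_abs_le_abs_sub z.re w.re
          rw [abs_sub_comm z.re] at this
          linarith
        have h6 : -(a * w.re) ≤ -(a * z.re) + |a| * η := by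
          have h7 : a * (z.re - w.re) ≤ |a| * η := by
            refine (le_abs_self _).trans ?_
            rw [abs_mul, abs_sub_comm]
            gcongr
          linarith
        calc Real.exp (-(a * w.re)) * (C₀ * Real.exp (-(1 / (m : ℝ) - η) * |w.re|))
            = C₀ * Real.exp (-(a * w.re) + -(1 / (m : ℝ) - η) * |w.re|) := by
              rw [Real.exp_add]
              ring
          _ ≤ C₀ * Real.exp (-(a * z.re) + |a| * η + 3 * η * η + -(2 * η + η) * |z.re|) := by
              refine mul_le_mul_of_nonneg_left (Real.exp_le_exp.mpr ?_) hC₀0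
              rw [hmη]
              nlinarith [mul_le_mul_of_nonneg_left h5 hη.le]
          _ = _ := by
              rw [Real.exp_add, Real.exp_add, Real.exp_add]
              ring)
    rw [norm_mul, Complex.norm_exp, hn]
    have h4 : ((a : ℂ) * z).re = a * z.re := by simp
    rw [h4]
    refine (mul_le_mul_of_nonneg_left h (Real.exp_pos _).le).trans (le_of_eq ?_)
    have h8 : Real.exp (a * z.re) * Real.exp (-(a * z.re)) = 1 := by
      rw [← Real.exp_add]
      simp
    calc _ = (Real.exp (a * z.re) * Real.exp (-(a * z.re))) *
          ((Real.exp (|a| * η) * C₀ * Real.exp (3 * η * η)) * (k.factorial / η ^ k) *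
            Real.exp (-(2 * η + η) * |z.re|)) := by ring
      _ = _ := by rw [h8, one_mul]
  · rw [hreal k]
    simp

end

/-! ### Fourier transforms and inversion of the local operator. -/

section

theorem integrable_exp_neg_mul_abs {c : ℝ} (hc : 0 < c) :
    Integrable fun x : ℝ => Real.exp (-c * |x|) := by
  have h : IntegrableOn (fun x : ℝ => Real.exp (-c * |x|)) (Set.Ioi 0) := by
    refine (integrableOn_exp_mul_Ioi (neg_lt_zero.mpr hc) 0).congr_fun (fun x hx => ?_)
      measurableSet_Ioi
    simp only [abs_of_pos (Set.mem_Ioi.mp hx)]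
  have h' : IntegrableOn (fun x : ℝ => Real.exp (-c * |x|)) (Set.Iic 0) := by
    refine (integrableOn_exp_mul_Iic hc 0).congr_fun (fun x hx => ?_) measurableSet_Iic
    simp only [abs_of_nonpos (Set.mem_Iic.mp hx)]
    ring_nf
  rw [← integrableOn_univ, ← Set.Iic_union_Ioi (a := (0 : ℝ))]
  exact h'.union h

open scoped FourierTransform

/-- Convolution of an integrable function with a probability measure, on a product space. -/
theorem integrable_prod_comp_sub {f : ℝ → ℂ} (hf : Integrable f) (hfc : Continuous f)
    (ν : Measure ℝ) [IsProbabilityMeasure ν] :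
    Integrable (fun p : ℝ × ℝ => f (p.1 - p.2)) (volume.prod ν) := by
  rw [integrable_prod_iff' (by fun_prop)]
  refine ⟨ae_of_all _ fun s => hf.comp_sub_right s, ?_⟩
  simp_rw [integral_sub_right_eq_self fun x => ‖f x‖]
  exact integrable_const _

theorem fourier_integral_comp_sub {f : ℝ → ℂ} (hf : Integrable f) (hfc : Continuous f)
    (ν : Measure ℝ) [IsProbabilityMeasure ν] (ξ : ℝ) :
    𝓕 (fun x => ∫ s, f (x - s) ∂ν) ξ =
      (∫ s, Complex.exp ((-2 * Real.pi * s * ξ : ℝ) * Complex.I) ∂ν) * 𝓕 f ξ := by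
  have hint := integrable_prod_comp_sub hf hfc ν
  have hexp : ∀ y : ℝ, ‖Complex.exp ((y : ℂ) * Complex.I)‖ = 1 := Complex.norm_exp_ofReal_mul_I
  rw [Real.fourier_real_eq_integral_exp_smul]
  simp_rw [← integral_smul]
  rw [integral_integral_swap, ← integral_mul_const]
  · congr 1
    funext s
    rw [Real.fourier_real_eq_integral_exp_smul, ← integral_const_mul]
    refine Eq.trans ?_ (integral_sub_right_eq_self _ s)
    congr 1
    funext x
    rw [smul_eq_mul, smul_eq_mul, ← mul_assoc, ← Complex.exp_add]
    congr 2
    push_cast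
    ring
  · refine hint.norm.mono' (by fun_prop) (ae_of_all _ fun p => ?_)
    simp only [Function.uncurry]
    rw [norm_smul, hexp, one_mul]

/-- The difference has Fourier transform 0, which is trivially integrable, so the inversion formula
applies to it. -/
theorem eq_of_fourier_eq {f g : ℝ → ℂ} (hf : Integrable f) (hfc : Continuous f) (hg : Integrable g)
    (hgc : Continuous g) (h : ∀ ξ, 𝓕 f ξ = 𝓕 g ξ) : f = g := by
  have h1 : 𝓕 (fun x => f x - g x) = 0 := by
    funext ξ
    have h2 := h ξ
    rw [Real.fourier_real_eq_integral_exp_smul, Real.fourier_real_eq_integral_exp_smul] at h2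
    rw [Real.fourier_real_eq_integral_exp_smul]
    simp_rw [smul_sub]
    have hi : ∀ {u : ℝ → ℂ}, Integrable u → Continuous u → Integrable fun v : ℝ =>
        Complex.exp ((-2 * Real.pi * v * ξ : ℝ) * Complex.I) • u v := by
      intro u hu huc
      refine hu.norm.mono' (by fun_prop) (ae_of_all _ fun v => ?_)
      rw [norm_smul, Complex.norm_exp_ofReal_mul_I, one_mul]
    rw [integral_sub (hi hf hfc) (hi hg hgc), h2, sub_self]
    rfl
  have h3 := Continuous.fourierInv_fourier_eq (f := fun x => f x - g x) (hfc.sub hgc) (hf.sub hg)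
    (by rw [h1]; exact integrable_zero _ _ _)
  rw [h1] at h3
  funext x
  have h4 := congrFun h3 x
  rw [Real.fourierInv_eq'] at h4
  simp only [Pi.zero_apply, smul_zero, integral_zero] at h4
  exact (sub_eq_zero.mp h4.symm)

/-- Inversion of a local operator by convolution with a probability measure. -/
theorem hasSum_integral_comp_sub {a c : ℝ} {ψ : ℕ → ℝ → ℂ} {D : ℕ → ℝ} (hc : 0 < c)
    (hderiv : ∀ k x, HasDerivAt (ψ k) (ψ (k + 1) x + a * ψ k x) x)
    (hbound : ∀ k x, ‖ψ k x‖ ≤ D k * Real.exp (-c * |x|)) {b : ℕ → ℂ}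
    (hs : Summable fun k => ‖b k‖ * D k) {f : ℂ → ℂ} (hf : ∀ ζ, HasSum (fun k => b k * ζ ^ k) (f ζ))
    (ν : Measure ℝ) [IsProbabilityMeasure ν]
    (hν : ∀ ξ : ℝ, (∫ s, Complex.exp ((-2 * Real.pi * s * ξ : ℝ) * Complex.I) ∂ν) *
      f (a - 2 * Real.pi * Complex.I * ξ) = 1) (x : ℝ) :
    HasSum (fun k => b k * (-1) ^ k * ∫ s, ψ k (x - s) ∂ν) (ψ 0 x) := by
  have hcont : ∀ k, Continuous (ψ k) := fun k =>
    continuous_iff_continuousAt.mpr fun x => (hderiv k x).continuousAt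
  have hE := integrable_exp_neg_mul_abs hc
  have hE1 : ∀ x : ℝ, Real.exp (-c * |x|) ≤ 1 := fun x =>
    Real.exp_le_one_iff.mpr (by nlinarith [abs_nonneg x])
  have hD : ∀ k, 0 ≤ D k := fun k =>
    nonneg_of_mul_nonneg_left ((norm_nonneg _).trans (hbound k 0)) (Real.exp_pos _)
  have hint : ∀ k, Integrable (ψ k) := fun k =>
    (hE.const_mul (D k)).mono' (hcont k).aestronglyMeasurable (ae_of_all _ (hbound k))
  have hβ : ∀ k, ‖b k * (-1) ^ k‖ = ‖b k‖ := fun k => by simp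
  have hterm : ∀ k x, ‖b k * (-1) ^ k * ψ k x‖ ≤ ‖b k‖ * D k * Real.exp (-c * |x|) := by
    intro k x
    rw [norm_mul, hβ, mul_assoc]
    gcongr
    exact hbound k x
  have hterm1 : ∀ k x, ‖b k * (-1) ^ k * ψ k x‖ ≤ ‖b k‖ * D k := fun k x =>
    (hterm k x).trans (mul_le_of_le_one_right (mul_nonneg (norm_nonneg _) (hD k)) (hE1 x))
  -- The operator is applied before the convolution: Ψ has transform f(a - 2πiξ) times that of ψ₀,
  -- and convolving with `ν` cancels the factor.
  let Ψ : ℝ → ℂ := fun x => ∑' k, b k * (-1) ^ k * ψ k x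
  have hΨc : Continuous Ψ := continuous_tsum (fun k => by have := hcont k; fun_prop) hs hterm1
  have hΨi : Integrable Ψ := by
    refine (hE.const_mul (∑' k, ‖b k‖ * D k)).mono' hΨc.aestronglyMeasurable
      (ae_of_all _ fun x => ?_)
    rw [← tsum_mul_right]
    exact tsum_of_norm_bounded (hs.mul_right _).hasSum fun k => hterm k x
  -- The relation ψ_{k+1} = ψ_k' - a ψ_k becomes multiplication by 2πiξ - a.
  have hfour : ∀ k ξ, 𝓕 (ψ k) ξ = (2 * Real.pi * Complex.I * ξ - a) ^ k * 𝓕 (ψ 0) ξ := by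
    intro k ξ
    induction k with
    | zero => simp
    | succ k ih =>
      have hd : deriv (ψ k) = fun x => ψ (k + 1) x + a * ψ k x := funext fun x => (hderiv k x).deriv
      have hi1 : Integrable (fun x => (a : ℂ) * ψ k x) := (hint k).const_mul _
      have h1 := congrFun (Real.fourier_deriv (hint k) (fun x => (hderiv k x).differentiableAt)
        (by rw [hd]; exact (hint (k + 1)).add hi1)) ξ
      have hi : ∀ {u : ℝ → ℂ}, Integrable u → Continuous u → Integrable fun v : ℝ =>
          Complex.exp ((-2 * Real.pi * v * ξ : ℝ) * Complex.I) • u v := by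
        intro u hu huc
        refine hu.norm.mono' (by fun_prop) (ae_of_all _ fun v => ?_)
        rw [norm_smul, Complex.norm_exp_ofReal_mul_I, one_mul]
      have h2 : 𝓕 (deriv (ψ k)) ξ = 𝓕 (ψ (k + 1)) ξ + a * 𝓕 (ψ k) ξ := by
        rw [hd]
        simp only [Real.fourier_real_eq_integral_exp_smul]
        simp_rw [smul_add]
        rw [integral_add (hi (hint (k + 1)) (hcont _))
          (hi hi1 (continuous_const.mul (hcont k))), ← integral_const_mul]
        congr 2
        funext v
        simp only [smul_eq_mul]
        ring
      rw [h2, smul_eq_mul] at h1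
      rw [pow_succ', mul_assoc, ← ih, sub_mul, ← h1]
      ring
  have hFΨ : ∀ ξ, 𝓕 Ψ ξ = f (a - 2 * Real.pi * Complex.I * ξ) * 𝓕 (ψ 0) ξ := by
    intro ξ
    have h1 : HasSum (fun k => b k * (-1) ^ k * 𝓕 (ψ k) ξ) (𝓕 Ψ ξ) := by
      have h2 := hasSum_integral_of_summable_integral_norm (μ := (volume : Measure ℝ))
        (F := fun k v => Complex.exp ((-2 * Real.pi * v * ξ : ℝ) * Complex.I) •
          (b k * (-1) ^ k * ψ k v)) (fun k => ?_) ?_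
      · have h3 : 𝓕 Ψ ξ = ∫ v : ℝ, ∑' k, Complex.exp ((-2 * Real.pi * v * ξ : ℝ) * Complex.I) •
            (b k * (-1) ^ k * ψ k v) := by
          rw [Real.fourier_real_eq_integral_exp_smul]
          simp only [smul_eq_mul, Ψ, tsum_mul_left]
        rw [h3]
        refine h2.congr_fun fun k => ?_
        rw [Real.fourier_real_eq_integral_exp_smul, ← integral_const_mul]
        congr 1
        funext v
        simp only [smul_eq_mul]
        ring
      · refine ((hint k).const_mul (b k * (-1) ^ k)).norm.mono' ?_ (ae_of_all _ fun v => ?_)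
        · have := hcont k
          fun_prop
        · rw [norm_smul, Complex.norm_exp_ofReal_mul_I, one_mul]
      · refine (hs.mul_right (∫ x : ℝ, Real.exp (-c * |x|))).of_nonneg_of_le
          (fun k => integral_nonneg fun _ => norm_nonneg _) fun k => ?_
        rw [← integral_const_mul]
        refine integral_mono_of_nonneg (ae_of_all _ fun _ => norm_nonneg _) (hE.const_mul _)
          (ae_of_all _ fun v => ?_)
        dsimp only
        rw [norm_smul, Complex.norm_exp_ofReal_mul_I, one_mul]
        exact hterm k v
    refine h1.unique ?_
    refine ((hf (a - 2 * Real.pi * Complex.I * ξ)).mul_right (𝓕 (ψ 0) ξ)).congr_fun fun k => ?_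
    rw [hfour, ← mul_assoc, mul_assoc (b k), ← mul_pow]
    congr 3
    ring
  have hconv : (fun x => ∫ s, Ψ (x - s) ∂ν) = ψ 0 := by
    refine eq_of_fourier_eq (integrable_prod_comp_sub hΨi hΨc ν).integral_prod_left ?_ (hint 0)
      (hcont 0) fun ξ => ?_
    · refine continuous_of_dominated (bound := fun _ => ∑' k, ‖b k‖ * D k) (fun x => by fun_prop)
        (fun x => ae_of_all _ fun s => tsum_of_norm_bounded hs.hasSum fun k => hterm1 k _)
        (integrable_const _) (ae_of_all _ fun s => by fun_prop)
    · rw [fourier_integral_comp_sub hΨi hΨc ν, hFΨ, ← mul_assoc, hν, one_mul]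
  have h2 := hasSum_integral_of_summable_integral_norm (μ := ν)
    (F := fun k s => b k * (-1) ^ k * ψ k (x - s)) (fun k => ?_) ?_
  · rw [← hconv]
    simpa only [integral_const_mul] using h2
  · refine (integrable_const (‖b k‖ * D k)).mono' ?_ (ae_of_all _ fun s => hterm1 k _)
    have := hcont k
    fun_prop
  · refine hs.of_nonneg_of_le (fun k => integral_nonneg fun _ => norm_nonneg _) fun k => ?_
    refine (integral_mono_of_nonneg (ae_of_all _ fun _ => norm_nonneg _)
      (integrable_const (‖b k‖ * D k)) (ae_of_all _ fun s => hterm1 k _)).trans ?_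
    simp

end

/-! ### Averaging over heat times, and its transpose on test functions. -/

section

open ProbabilityTheory

/-- Lets continuous maps into `boundedHolo n` be strongly measurable through second countability of
the source, with no separability of the target. -/
instance (n : ℕ+) {α : Type*} [TopologicalSpace α] [SecondCountableTopology α] :
    SecondCountableTopologyEither α (boundedHolo n) :=
  ⟨Or.inl inferInstance⟩

/-- `ψ` is holomorphic on a neighbourhood of the closed strip `|Im z| ≤ 1/n` and decays there faster
than `e^{-|Re z|/n}`. -/
structure IsStripDecay (n : ℕ+) (δ C : ℝ) (ψ : ℂ → ℂ) : Prop where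
  pos : 0 < δ
  nonneg : 0 ≤ C
  differentiableAt : ∀ z : ℂ, |z.im| ≤ 1 / n → DifferentiableAt ℂ ψ z
  norm_le : ∀ z : ℂ, |z.im| ≤ 1 / n → ‖ψ z‖ ≤ C * Real.exp (-(1 / n + δ) * |z.re|)

namespace IsStripDecay

variable {n : ℕ+} {δ C : ℝ} {ψ : ℂ → ℂ}

theorem norm_translate_le (h : IsStripDecay n δ C ψ) {κ : ℝ} (hκ : 0 ≤ κ) (hκ' : κ ≤ 1 / n + δ)
    (s : ℝ) {z : ℂ} (hz : |z.im| ≤ 1 / n) :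
    ‖ψ (z - s)‖ ≤ C * Real.exp (κ * |s|) * Real.exp (-κ * |z.re|) := by
  have hC := h.nonneg
  refine (h.norm_le (z - s) (by simpa using hz)).trans ?_
  rw [mul_assoc, ← Real.exp_add]
  gcongr
  simp only [Complex.sub_re, Complex.ofReal_re]
  have h1 : |z.re| ≤ |z.re - s| + |s| := by simpa using abs_add_le (z.re - s) s
  nlinarith [mul_le_mul_of_nonneg_left h1 hκ, mul_le_mul_of_nonneg_right hκ' (abs_nonneg (z.re - s))]

theorem differentiableOn_translate (h : IsStripDecay n δ C ψ) (s : ℝ) :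
    DifferentiableOn ℂ (fun z => ψ (z - s)) (strip (n : ℝ)) := fun z hz => by
  have h1 := h.differentiableAt (z - s) (by simpa using abs_im_le_of_mem_strip hz)
  exact (h1.comp z (by fun_prop : DifferentiableAt ℂ (fun z : ℂ => z - s) z)).differentiableWithinAt

theorem norm_translate_le' (h : IsStripDecay n δ C ψ) (s : ℝ) {z : ℂ} (hz : z ∈ strip (n : ℝ)) :
    ‖ψ (z - s)‖ ≤ C * Real.exp |s| * Real.exp (-(|z.re| / n)) := by
  have hC := h.nonneg
  have hn : (1 : ℝ) ≤ n := by exact_mod_cast n.pos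
  refine (h.norm_translate_le (κ := 1 / n) (by positivity) (by linarith [h.pos]) s
    (abs_im_le_of_mem_strip hz)).trans ?_
  rw [neg_mul, one_div_mul_eq_div (n : ℝ) |z.re|, one_div_mul_eq_div]
  gcongr
  exact div_le_self (abs_nonneg _) hn

theorem isBoundedHolo_translate (h : IsStripDecay n δ C ψ) (s : ℝ) :
    IsBoundedHolo n fun z => ψ (z - s) :=
  ⟨h.differentiableOn_translate s, _, fun _ hz => h.norm_translate_le' s hz⟩

theorem norm_ofHolo_translate_le (h : IsStripDecay n δ C ψ) (s : ℝ) :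
    ‖ofHolo n fun z => ψ (z - s)‖ ≤ C * Real.exp |s| :=
  norm_ofHolo_le (by have := h.nonneg; positivity) fun _ hz => h.norm_translate_le' s hz

theorem realEval_translate (h : IsStripDecay n δ C ψ) (s y : ℝ) :
    realEval n y (ofHolo n fun z => ψ (z - s)) = ψ ((y - s : ℝ) : ℂ) := by
  rw [realEval_ofHolo (h.isBoundedHolo_translate s)]
  simp

theorem continuous_ofHolo_translate (h : IsStripDecay n δ C ψ) :
    Continuous fun s : ℝ => ofHolo n fun z => ψ (z - s) := by
  refine continuous_iff_continuousAt.mpr fun s => ?_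
  refine continuousAt_ofHolo (δ := δ) (K := fun s => C * Real.exp ((1 / n + δ) * |s|)) h.pos
    (by fun_prop) (fun z hz => ?_) (Eventually.of_forall h.differentiableOn_translate)
    (Eventually.of_forall fun s z hz => ?_)
  · have h1 := (h.differentiableAt (z - s) (by simpa using hz)).continuousAt
    exact ContinuousAt.comp (f := fun q : ℝ × ℂ => q.2 - (q.1 : ℂ)) (x := (s, z)) h1 (by fun_prop)
  · have := h.pos
    exact h.norm_translate_le (by positivity) le_rfl s (abs_im_le_of_mem_strip hz)

theorem continuous_real (h : IsStripDecay n δ C ψ) : Continuous fun x : ℝ => ψ x :=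
  continuous_iff_continuousAt.mpr fun x =>
    (h.differentiableAt x (by simp)).continuousAt.comp Complex.continuous_ofReal.continuousAt

end IsStripDecay

theorem integrable_exp_mul_abs_gaussian (κ : ℝ) :
    Integrable (fun u : ℝ => Real.exp |κ * u|) (gaussianReal 0 1) := by
  refine ((integrable_exp_mul_gaussianReal κ).add (integrable_exp_mul_gaussianReal (-κ))).mono'
    (by fun_prop) (ae_of_all _ fun u => ?_)
  rw [Real.norm_eq_abs, Real.abs_exp]
  simp only [Pi.add_apply]
  rcases abs_cases (κ * u) with h | h
  · rw [h.1]
    linarith [Real.exp_pos (-κ * u)]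
  · rw [h.1, ← neg_mul]
    linarith [Real.exp_pos (κ * u)]

theorem integral_exp_mul_gaussian (κ : ℝ) :
    ∫ u : ℝ, Real.exp (κ * u) ∂gaussianReal 0 1 = Real.exp (κ ^ 2 / 2) := by
  have h := mgf_gaussianReal (X := id) (p := gaussianReal 0 1) (μ := 0) (v := 1) (by simp) κ
  rw [mgf] at h
  simpa using h

/-- For fixed t > 0 the Gaussian integral is at most 2e^t, so one exponential moment of μ suffices.
-/
theorem integrable_exp_abs_sqrt_mul {μ : Measure ℝ} [IsProbabilityMeasure μ]
    (hpos : ∀ᵐ t ∂μ, 0 < t) (hexp : Integrable Real.exp μ) :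
    Integrable (fun p : ℝ × ℝ => Real.exp |Real.sqrt (2 * p.1) * p.2|)
      (μ.prod (gaussianReal 0 1)) := by
  rw [integrable_prod_iff (by fun_prop)]
  refine ⟨ae_of_all _ fun t => integrable_exp_mul_abs_gaussian (Real.sqrt (2 * t)), ?_⟩
  refine (hexp.const_mul 2).mono' ?_ ?_
  · exact (Continuous.aestronglyMeasurable (by fun_prop :
      Continuous fun p : ℝ × ℝ => ‖Real.exp |Real.sqrt (2 * p.1) * p.2|‖)).integral_prod_right'
  · filter_upwards [hpos] with t ht
    rw [Real.norm_of_nonneg (integral_nonneg fun _ => norm_nonneg _)]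
    simp only [Real.norm_eq_abs, Real.abs_exp]
    have h1 := integrable_exp_mul_gaussianReal (μ := 0) (v := 1) (Real.sqrt (2 * t))
    have h2 := integrable_exp_mul_gaussianReal (μ := 0) (v := 1) (-Real.sqrt (2 * t))
    have h3 : Real.sqrt (2 * t) ^ 2 / 2 = t := by
      rw [Real.sq_sqrt (by positivity)]
      ring
    calc ∫ u, Real.exp |Real.sqrt (2 * t) * u| ∂gaussianReal 0 1
        ≤ ∫ u, (Real.exp (Real.sqrt (2 * t) * u) + Real.exp (-Real.sqrt (2 * t) * u))
            ∂gaussianReal 0 1 := by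
          refine integral_mono (integrable_exp_mul_abs_gaussian _) (h1.add h2) fun u => ?_
          dsimp only
          rcases abs_cases (Real.sqrt (2 * t) * u) with h | h
          · rw [h.1]
            linarith [Real.exp_pos (-Real.sqrt (2 * t) * u)]
          · rw [h.1, ← neg_mul]
            linarith [Real.exp_pos (Real.sqrt (2 * t) * u)]
      _ = 2 * Real.exp t := by
          rw [integral_add h1 h2, integral_exp_mul_gaussian, integral_exp_mul_gaussian, neg_sq, h3]
          ring

theorem integral_comp_sqrt_mul_gaussian {f : ℝ → ℂ} {t : ℝ} (ht : 0 < t) (y : ℝ)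
    (hf : Continuous f) :
    ∫ u, f (y - Real.sqrt (2 * t) * u) ∂gaussianReal 0 1 = ∫ x : ℝ, f x * heat t x y := by
  have h1 : ∫ u, f (y - Real.sqrt (2 * t) * u) ∂gaussianReal 0 1 =
      ∫ v, f (y - v) ∂(gaussianReal 0 1).map (fun u => Real.sqrt (2 * t) * u) :=
    (integral_map (φ := fun u => Real.sqrt (2 * t) * u) (f := fun v => f (y - v))
      (by fun_prop) (by fun_prop)).symm
  have hv : (NNReal.mk (Real.sqrt (2 * t) ^ 2) (sq_nonneg _) * 1 : NNReal) ≠ 0 := by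
    rw [mul_one, Ne, ← NNReal.coe_eq_zero]
    simp only [NNReal.coe_mk]
    positivity
  rw [h1, gaussianReal_map_const_mul, integral_gaussianReal_eq_integral_smul hv,
    ← integral_sub_left_eq_self _ volume y]
  congr 1
  funext x
  rw [gaussianPDFReal, heat, sub_sub_cancel, Complex.real_smul, mul_comm]
  congr 1
  have h2 : ((NNReal.mk (Real.sqrt (2 * t) ^ 2) (sq_nonneg _) * 1 : NNReal) : ℝ) = 2 * t := by
    rw [mul_one, NNReal.coe_mk, Real.sq_sqrt (by positivity)]
  rw [mul_zero, h2, Complex.ofReal_mul, Complex.ofReal_exp]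
  congr 2
  · ring_nf
  · push_cast
    ring_nf

variable {X : Type*} [NormedAddCommGroup X] [NormedSpace ℂ X] {a : ℝ}

/-- The convolution of ψ with the heat kernel is a superposition of heat kernels and also one of
translates of ψ. Both are Bochner integrals in `boundedHolo n`, they agree at real points, and `G`
commutes with them. -/
theorem Q.integral_smul_heatExtension [CompleteSpace X] (G : Q a X) {n : ℕ+} {δ C : ℝ} {ψ : ℂ → ℂ}
    (h : IsStripDecay n δ C ψ) {t : ℝ} (ht : 0 < t) :
    ∫ x : ℝ, ψ x • G.heatExtension t x =
      ∫ u, G.restrict n (ofHolo n fun z => ψ (z - (Real.sqrt (2 * t) * u : ℝ)))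
        ∂gaussianReal 0 1 := by
  have hn : (0 : ℝ) < n := by exact_mod_cast n.pos
  have hC := h.nonneg
  have hheat : Continuous fun x : ℝ => ofHolo n (heat t x) :=
    continuous_iff_continuousAt.mpr fun x =>
      ContinuousAt.comp (f := fun x : ℝ => (t, x)) (x := x)
        (continuousAt_ofHolo_heat n (p₀ := (t, x)) ht) (by fun_prop)
  have hint1 : Integrable fun x : ℝ => ψ x • ofHolo n (heat t x) := by
    refine ((integrable_exp_neg_mul_abs h.pos).const_mul
      (C * (n * Real.exp (2 / ((n : ℝ) ^ 2 * t)) * Real.exp t))).mono'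
      (h.continuous_real.smul hheat).aestronglyMeasurable (ae_of_all _ fun x => ?_)
    rw [norm_smul]
    refine (mul_le_mul (h.norm_le x (by simp)) (norm_ofHolo_heat_le n ht x) (norm_nonneg _)
      (by positivity)).trans (le_of_eq ?_)
    rw [Complex.ofReal_re, show -δ * |x| = -(1 / n + δ) * |x| + |x| / n by ring, Real.exp_add]
    ring
  have hint2 : Integrable (fun u : ℝ =>
      ofHolo n fun z => ψ (z - (Real.sqrt (2 * t) * u : ℝ))) (gaussianReal 0 1) := by
    refine ((integrable_exp_mul_abs_gaussian (Real.sqrt (2 * t))).const_mul C).mono'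
      (h.continuous_ofHolo_translate.comp (by fun_prop : Continuous fun u : ℝ =>
        Real.sqrt (2 * t) * u)).aestronglyMeasurable (ae_of_all _ fun u => ?_)
    exact h.norm_ofHolo_translate_le _
  have h1 : ∀ x : ℝ, ψ x • G.heatExtension t x = G.restrict n (ψ x • ofHolo n (heat t x)) :=
    fun x => by rw [map_smul, G.heatExtension_eq n ht]
  simp_rw [h1]
  rw [ContinuousLinearMap.integral_comp_comm _ hint1, ContinuousLinearMap.integral_comp_comm _ hint2]
  refine G.restrict_congr fun y => ?_
  rw [← ContinuousLinearMap.integral_comp_comm _ hint1,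
    ← ContinuousLinearMap.integral_comp_comm _ hint2]
  simp_rw [h.realEval_translate, map_smul, realEval_ofHolo (isBoundedHolo_heat n ht _), smul_eq_mul]
  exact (integral_comp_sqrt_mul_gaussian (f := fun x : ℝ => ψ x) ht y h.continuous_real).symm

section Average

variable {μ : Measure ℝ} {G : Q a X} {B : ℕ → ℝ} {m : ℝ → ℝ}

/-- The average of the heat extension of `G` over a random time. -/
def Q.average (G : Q a X) (μ : Measure ℝ) (x : ℝ) : X := ∫ t, G.heatExtension t x ∂μ

theorem Q.norm_average_le (hpos : ∀ᵐ t ∂μ, 0 < t) (hm : Integrable m μ)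
    (hG : ∀ t : ℝ, 0 < t → ∀ (x : ℝ) (N : ℕ),
      ‖G.heatExtension t x‖ ≤ B N * m t * Real.exp (|x| / (N + 1))) (x : ℝ) (N : ℕ) :
    ‖G.average μ x‖ ≤ B N * (∫ t, m t ∂μ) * Real.exp (|x| / (N + 1)) := by
  rw [← integral_const_mul, ← integral_mul_const]
  refine norm_integral_le_of_norm_le ((hm.const_mul _).mul_const _) ?_
  filter_upwards [hpos] with t ht
  exact hG t ht x N

theorem Q.continuous_average (hpos : ∀ᵐ t ∂μ, 0 < t) (hm : Integrable m μ)
    (hG : ∀ t : ℝ, 0 < t → ∀ (x : ℝ) (N : ℕ),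
      ‖G.heatExtension t x‖ ≤ B N * m t * Real.exp (|x| / (N + 1))) :
    Continuous (G.average μ) := by
  refine continuous_iff_continuousAt.mpr fun x₀ => ?_
  have hcont : ∀ t : ℝ, 0 < t → Continuous fun x => G.heatExtension t x := fun t ht =>
    continuous_iff_continuousAt.mpr fun x =>
      ContinuousAt.comp (f := fun x : ℝ => (t, x)) (x := x)
        (G.continuousAt_heatExtension (p₀ := (t, x)) ht) (by fun_prop)
  have h1 : μ.restrict (Set.Ioi 0) = μ := Measure.restrict_eq_self_of_ae_mem hpos
  refine continuousAt_of_dominated (bound := fun t => |B 0 * m t| * Real.exp (|x₀| + 1))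
    (Eventually.of_forall fun x => ?_) ?_ ((hm.const_mul _).abs.mul_const _) ?_
  · rw [← h1]
    refine ContinuousOn.aestronglyMeasurable (fun t ht => ContinuousAt.continuousWithinAt ?_)
      measurableSet_Ioi
    exact ContinuousAt.comp (f := fun t : ℝ => (t, x)) (x := t)
      (G.continuousAt_heatExtension (p₀ := (t, x)) ht) (by fun_prop)
  · filter_upwards [Metric.ball_mem_nhds x₀ one_pos] with x hx
    filter_upwards [hpos] with t ht
    refine (hG t ht x 0).trans (mul_le_mul (le_abs_self _) (Real.exp_le_exp.mpr ?_)
      (Real.exp_pos _).le (abs_nonneg _))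
    rw [Metric.mem_ball, Real.dist_eq] at hx
    have := abs_sub_abs_le_abs_sub x x₀
    simp only [Nat.cast_zero, zero_add, div_one]
    linarith
  · filter_upwards [hpos] with t ht
    exact (hcont t ht).continuousAt

end Average

/-- The average of the translates of `ψ` by `√(2t) u`, with `t` distributed according to `μ` and
`u` standard normal. -/
def heatAverage (μ : Measure ℝ) (n : ℕ+) (ψ : ℂ → ℂ) : boundedHolo n :=
  ∫ p : ℝ × ℝ, ofHolo n (fun z => ψ (z - (Real.sqrt (2 * p.1) * p.2 : ℝ))) ∂μ.prod (gaussianReal 0 1)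

section Mixture

variable {μ : Measure ℝ} [IsProbabilityMeasure μ] {G : Q a X} {B : ℕ → ℝ} {m : ℝ → ℝ}

theorem integrable_ofHolo_translate (hpos : ∀ᵐ t ∂μ, 0 < t) (hexp : Integrable Real.exp μ)
    {n : ℕ+} {δ C : ℝ} {ψ : ℂ → ℂ} (h : IsStripDecay n δ C ψ) :
    Integrable (fun p : ℝ × ℝ => ofHolo n fun z => ψ (z - (Real.sqrt (2 * p.1) * p.2 : ℝ)))
      (μ.prod (gaussianReal 0 1)) :=
  ((integrable_exp_abs_sqrt_mul hpos hexp).const_mul C).mono'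
    (h.continuous_ofHolo_translate.comp (by fun_prop : Continuous fun p : ℝ × ℝ =>
      Real.sqrt (2 * p.1) * p.2)).aestronglyMeasurable
    (ae_of_all _ fun _ => h.norm_ofHolo_translate_le _)

theorem norm_heatAverage_le (hpos : ∀ᵐ t ∂μ, 0 < t) (hexp : Integrable Real.exp μ)
    {n : ℕ+} {δ C : ℝ} {ψ : ℂ → ℂ} (h : IsStripDecay n δ C ψ) :
    ‖heatAverage μ n ψ‖ ≤
      C * ∫ p : ℝ × ℝ, Real.exp |Real.sqrt (2 * p.1) * p.2| ∂μ.prod (gaussianReal 0 1) := by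
  rw [← integral_const_mul]
  exact norm_integral_le_of_norm_le ((integrable_exp_abs_sqrt_mul hpos hexp).const_mul C)
    (ae_of_all _ fun _ => h.norm_ofHolo_translate_le _)

theorem realEval_heatAverage (hpos : ∀ᵐ t ∂μ, 0 < t) (hexp : Integrable Real.exp μ)
    {n : ℕ+} {δ C : ℝ} {ψ : ℂ → ℂ} (h : IsStripDecay n δ C ψ) (y : ℝ) :
    realEval n y (heatAverage μ n ψ) =
      ∫ s : ℝ, ψ ((y - s : ℝ) : ℂ) ∂(μ.prod (gaussianReal 0 1)).map
        (fun p : ℝ × ℝ => Real.sqrt (2 * p.1) * p.2) := by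
  have hc : Continuous fun s : ℝ => ψ ((y - s : ℝ) : ℂ) :=
    h.continuous_real.comp (by fun_prop : Continuous fun s : ℝ => y - s)
  rw [heatAverage, ← ContinuousLinearMap.integral_comp_comm _
    (integrable_ofHolo_translate hpos hexp h), integral_map (by fun_prop) hc.aestronglyMeasurable]
  simp_rw [h.realEval_translate]

/-- Given t, the variable √(2t)u is Gaussian of variance 2t, with characteristic function
e^{-t(2πξ)²} here; averaging over t gives the Laplace transform of μ. -/
theorem charFun_heatMixture (hpos : ∀ᵐ t ∂μ, 0 < t) (ξ : ℝ) :
    ∫ s : ℝ, Complex.exp ((-2 * Real.pi * s * ξ : ℝ) * Complex.I)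
      ∂(μ.prod (gaussianReal 0 1)).map (fun p : ℝ × ℝ => Real.sqrt (2 * p.1) * p.2) =
      ((∫ t, Real.exp (-(2 * Real.pi * ξ) ^ 2 * t) ∂μ : ℝ) : ℂ) := by
  rw [integral_map (by fun_prop) (by fun_prop), integral_prod, ← integral_complex_ofReal]
  · refine integral_congr_ae ?_
    filter_upwards [hpos] with t ht
    have h := charFun_gaussianReal (μ := 0) (v := 1) (-2 * Real.pi * Real.sqrt (2 * t) * ξ)
    rw [charFun_apply_real] at h
    convert h using 1
    · congr 1
      funext u
      congr 1
      push_cast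
      ring
    · rw [Complex.ofReal_exp]
      congr 1
      have h2 : (Real.sqrt (2 * t) : ℂ) ^ 2 = 2 * t := by
        rw [← Complex.ofReal_pow, Real.sq_sqrt (by positivity)]
        push_cast
        ring
      push_cast
      simp only [mul_pow, h2]
      ring
  · refine (integrable_const (1 : ℝ)).mono' (by fun_prop) (ae_of_all _ fun p => ?_)
    rw [Complex.norm_exp_ofReal_mul_I]

theorem Q.aestronglyMeasurable_heatExtension (G : Q a X) (hpos : ∀ᵐ t ∂μ, 0 < t) :
    AEStronglyMeasurable (fun p : ℝ × ℝ => G.heatExtension p.2 p.1)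
      ((volume : Measure ℝ).prod μ) := by
  have h1 : μ.restrict (Set.Ioi 0) = μ := Measure.restrict_eq_self_of_ae_mem hpos
  have h2 : ((volume : Measure ℝ).prod μ).restrict (Set.univ ×ˢ Set.Ioi 0) =
      (volume : Measure ℝ).prod μ := by
    rw [← Measure.prod_restrict, Measure.restrict_univ, h1]
  rw [← h2]
  refine ContinuousOn.aestronglyMeasurable (fun p hp => ContinuousAt.continuousWithinAt ?_)
    (MeasurableSet.univ.prod measurableSet_Ioi)
  exact ContinuousAt.comp (f := Prod.swap) (x := p)
    (G.continuousAt_heatExtension (p₀ := p.swap) hp.2) continuous_swap.continuousAt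

theorem Q.integrable_smul_heatExtension (hpos : ∀ᵐ t ∂μ, 0 < t) (hm : Integrable m μ)
    (hG : ∀ t : ℝ, 0 < t → ∀ (x : ℝ) (N : ℕ),
      ‖G.heatExtension t x‖ ≤ B N * m t * Real.exp (|x| / (N + 1)))
    {n : ℕ+} {δ C : ℝ} {ψ : ℂ → ℂ} (h : IsStripDecay n δ C ψ) :
    Integrable (fun p : ℝ × ℝ => ψ p.1 • G.heatExtension p.2 p.1)
      ((volume : Measure ℝ).prod μ) := by
  have hC := h.nonneg
  have h0 : ∀ᵐ p ∂(volume : Measure ℝ).prod μ, 0 < p.2 := by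
    have h1 : ∀ᵐ t ∂((volume : Measure ℝ).prod μ).map Prod.snd, 0 < t :=
      (Measure.quasiMeasurePreserving_snd (μ := (volume : Measure ℝ)) (ν := μ)).absolutelyContinuous
        hpos
    exact ae_of_ae_map (by fun_prop) h1
  refine ((integrable_exp_neg_mul_abs h.pos).mul_prod (hm.const_mul (C * B (n.natPred)))).mono'
    (AEStronglyMeasurable.smul ?_ (G.aestronglyMeasurable_heatExtension hpos)) ?_
  · exact (h.continuous_real.comp continuous_fst).aestronglyMeasurable
  · filter_upwards [h0] with p hp
    -- N = n - 1 gives growth e^{|x|/n}, which the decay e^{-(1/n+δ)|x|} of ψ absorbs.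
    have h2 := hG p.2 hp p.1 n.natPred
    have h3 : ((n.natPred : ℕ) : ℝ) + 1 = n := by exact_mod_cast n.natPred_add_one
    rw [h3] at h2
    rw [norm_smul]
    refine (mul_le_mul (h.norm_le p.1 (by simp)) h2 (norm_nonneg _)
      (by positivity)).trans (le_of_eq ?_)
    rw [Complex.ofReal_re, show -δ * |p.1| = -(1 / n + δ) * |p.1| + |p.1| / n by ring, Real.exp_add]
    ring

theorem Q.integral_smul_average [CompleteSpace X] (hpos : ∀ᵐ t ∂μ, 0 < t) (hexp : Integrable Real.exp μ)
    (hm : Integrable m μ)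
    (hG : ∀ t : ℝ, 0 < t → ∀ (x : ℝ) (N : ℕ),
      ‖G.heatExtension t x‖ ≤ B N * m t * Real.exp (|x| / (N + 1)))
    {n : ℕ+} {δ C : ℝ} {ψ : ℂ → ℂ} (h : IsStripDecay n δ C ψ) :
    Integrable (fun x : ℝ => ψ x • G.average μ x) ∧
      ∫ x : ℝ, ψ x • G.average μ x = G.restrict n (heatAverage μ n ψ) := by
  have hint := Q.integrable_smul_heatExtension hpos hm hG h
  have hs : ∀ x : ℝ, ψ x • G.average μ x = ∫ t, ψ x • G.heatExtension t x ∂μ := fun x =>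
    (integral_smul _ _).symm
  simp_rw [hs]
  refine ⟨hint.integral_prod_left, ?_⟩
  have hint2 := integrable_ofHolo_translate hpos hexp h
  rw [integral_integral_swap hint, heatAverage, ← ContinuousLinearMap.integral_comp_comm _ hint2,
    integral_prod _ ((G.restrict n).integrable_comp hint2)]
  refine integral_congr_ae ?_
  filter_upwards [hpos] with t ht
  exact G.integral_smul_heatExtension h ht

end Mixture

end

/-! ### Assembly of the operator and the function. -/

section

open ProbabilityTheory

theorem charFun_heatMixture_mul_eq_one {μ : Measure ℝ} [IsProbabilityMeasure μ]
    (hpos : ∀ᵐ t ∂μ, 0 < t) {c : ℕ → ℝ} (hc0 : ∀ j, 0 < c j)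
    (hlap : ∀ s : ℝ, 0 ≤ s → Tendsto (fun n => ∏ j ∈ Finset.range n, (1 + s * c j)⁻¹) atTop
      (𝓝 (∫ t, Real.exp (-s * t) ∂μ))) {f : ℂ → ℂ}
    (hf : ∀ ζ, Tendsto (fun n => ∏ j ∈ Finset.range n, (1 - (c j : ℂ) * ζ ^ 2)) atTop (𝓝 (f ζ)))
    (ξ : ℝ) :
    (∫ s : ℝ, Complex.exp ((-2 * Real.pi * s * ξ : ℝ) * Complex.I)
      ∂(μ.prod (gaussianReal 0 1)).map (fun p : ℝ × ℝ => Real.sqrt (2 * p.1) * p.2)) *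
      f (-(2 * Real.pi * Complex.I * ξ)) = 1 := by
  rw [charFun_heatMixture hpos]
  let s : ℝ := (2 * Real.pi * ξ) ^ 2
  have hs : 0 ≤ s := sq_nonneg _
  have h1 := (Complex.continuous_ofReal.tendsto _).comp (hlap s hs)
  refine tendsto_nhds_unique (h1.mul (hf _)) ?_
  refine tendsto_const_nhds.congr fun n => ?_
  have h2 : ∀ j, 1 - (c j : ℂ) * (-(2 * Real.pi * Complex.I * ξ)) ^ 2 =
      ((1 + s * c j : ℝ) : ℂ) := by
    intro j
    simp only [s]
    push_cast
    rw [neg_sq, mul_pow, mul_pow, mul_pow, Complex.I_sq]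
    ring
  simp_rw [h2]
  rw [Function.comp_apply, ← Complex.ofReal_prod, ← Complex.ofReal_mul, ← Finset.prod_mul_distrib,
    Finset.prod_eq_one, Complex.ofReal_one]
  intro j _
  have := hc0 j
  exact inv_mul_cancel₀ (by positivity)

variable {X : Type*} [NormedAddCommGroup X] [NormedSpace ℂ X] [CompleteSpace X] {a : ℝ}

/-- Every `G ∈ 𝒬_a(𝔻, X)` is a local operator applied to a continuous function. -/
theorem Q.exists_eqLocalOperatorApply (G : Q a X) :
    ∃ (b : ℕ → ℂ) (g : ℝ → X), IsLocalOperator b ∧ Continuous g ∧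
      (∀ ε : ℝ, 0 < ε → ∃ C : ℝ, 0 < C ∧
        ∀ x : ℝ, Real.exp (-a * x) * ‖g x‖ ≤ C * Real.exp (ε * |x|)) ∧
      EqLocalOperatorApply G b g := by
  obtain ⟨B, hB, hG⟩ := G.exists_heatExtension_le
  obtain ⟨c, μ, hc0, hcs, hct, hμ, hpos, hexp, hlap, hm⟩ := exists_adapted_mixture hB
  obtain ⟨f, hfd, hfl, hfg⟩ := exists_entire_product hc0 hcs hct
  -- The shift by `a` compensates for the factor e^{a·} in g: (d/dx - a)(e^{ax} u) = e^{ax} u'.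
  obtain ⟨b, hb, hbb⟩ := exists_taylor_coefficients (f := fun ζ => f (ζ - a))
    (hfd.comp (by fun_prop : Differentiable ℂ fun ζ : ℂ => ζ - a)) (fun ε hε => by
      obtain ⟨C, hC0, hC⟩ := hfg ε hε
      refine ⟨C * Real.exp (ε * |a|), by positivity, fun ζ => (hC _).trans ?_⟩
      rw [mul_assoc, ← Real.exp_add, ← mul_add]
      have h1 : ‖ζ - a‖ ≤ ‖ζ‖ + |a| := by simpa using norm_sub_le ζ (a : ℂ)
      gcongr
      linarith)
  have hexp_cancel : ∀ x : ℝ, (Real.exp (-(a * x)) : ℂ) * (Real.exp (a * x) : ℂ) = 1 := fun x => by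
    rw [← Complex.ofReal_mul, ← Real.exp_add]
    simp
  refine ⟨b, fun x => (Real.exp (a * x) : ℂ) • G.average μ x, isLocalOperator_of_bound hbb, ?_,
    fun ε hε => ?_, fun φ => ?_⟩
  · have h1 := Q.continuous_average hpos hm hG
    have h2 : Continuous fun x : ℝ => ((Real.exp (a * x) : ℝ) : ℂ) := by fun_prop
    exact h2.smul h1
  · obtain ⟨N, hN⟩ := exists_nat_one_div_lt hε
    have hBN := hB N
    have hI : 0 ≤ ∫ t, envelope B t * Real.exp t ∂μ := integral_nonneg fun t =>
      mul_nonneg (envelope_nonneg hB t) (Real.exp_pos t).le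
    refine ⟨B N * (∫ t, envelope B t * Real.exp t ∂μ) + 1, by positivity, fun x => ?_⟩
    have h1 := Q.norm_average_le hpos hm hG x N
    rw [norm_smul, Complex.norm_real, Real.norm_eq_abs, Real.abs_exp, ← mul_assoc, ← Real.exp_add,
      neg_mul, neg_add_cancel, Real.exp_zero, one_mul]
    refine h1.trans ?_
    gcongr
    · linarith
    · rw [div_eq_mul_one_div, mul_comm]
      gcongr
  · obtain ⟨n, δ, r, C, ψ, hδ, hr, hC, hψd, hψb, hψφ⟩ := φ.exists_iteratedDeriv_extension
    have hdec : ∀ k, IsStripDecay n δ (C * (k.factorial / r ^ k)) (ψ k) := fun k =>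
      ⟨hδ, by positivity, hψd k, hψb k⟩
    have hfun : ∀ k (t : ℝ), iteratedDeriv k φ t • (Real.exp (a * t) : ℂ) • G.average μ t =
        ψ k t • G.average μ t := by
      intro k t
      rw [smul_smul, hψφ, mul_comm]
    have hint := fun k => Q.integral_smul_average hpos hexp hm hG (hdec k)
    refine ⟨fun k => ?_, ?_⟩
    · simp_rw [hfun]
      exact (hint k).1
    simp_rw [hfun]
    have hsum : Summable fun k => ‖b k‖ * (C * (k.factorial / r ^ k)) := by
      -- The Cauchy bounds grow like k!/r^k, so coefficients of size (r/2)^k/k! leave a geometric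
      -- series of ratio 1/2.
      obtain ⟨D, hD0, hD⟩ := hbb (r / 2) (by positivity)
      refine ((summable_geometric_two.mul_left (C * D))).of_nonneg_of_le (fun k => by positivity)
        fun k => ?_
      calc ‖b k‖ * (C * (k.factorial / r ^ k)) = C * (‖b k‖ * k.factorial) / r ^ k := by ring
        _ ≤ C * (D * (r / 2) ^ k) / r ^ k := by
            exact div_le_div_of_nonneg_right (mul_le_mul_of_nonneg_left (hD k) hC) (by positivity)
        _ = C * D * (1 / 2) ^ k := by
            rw [div_pow, div_pow, one_pow]
            field_simp
    let L := ∫ p : ℝ × ℝ, Real.exp |Real.sqrt (2 * p.1) * p.2| ∂μ.prod (gaussianReal 0 1)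
    have hΘ : Summable fun k => (b k * (-1) ^ k) • heatAverage μ n (ψ k) := by
      refine Summable.of_norm_bounded (hsum.mul_right L) fun k => ?_
      rw [norm_smul, norm_mul, norm_pow, norm_neg, norm_one, one_pow, mul_one, mul_assoc]
      gcongr
      exact norm_heatAverage_le hpos hexp (hdec k)
    have hval := hΘ.hasSum.mapL (G.restrict n)
    -- The sum exists in norm; evaluation at real points identifies it with e^{a·}φ.
    have hlim : G.restrict n (∑' k, (b k * (-1) ^ k) • heatAverage μ n (ψ k)) = G φ := by
      refine G.restrict_eq fun y => ?_
      have h1 := hΘ.hasSum.mapL (realEval n y)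
      simp_rw [map_smul, smul_eq_mul, realEval_heatAverage hpos hexp (hdec _)] at h1
      have hν : IsProbabilityMeasure ((μ.prod (gaussianReal 0 1)).map
          (fun p : ℝ × ℝ => Real.sqrt (2 * p.1) * p.2)) :=
        Measure.isProbabilityMeasure_map (by fun_prop)
      have hφd : ∀ k, Differentiable ℝ (iteratedDeriv k φ) := fun k =>
        φ.2.1.differentiable_iteratedDeriv k (by exact_mod_cast ENat.natCast_lt_top k)
      have h2 := hasSum_integral_comp_sub (a := a) (ψ := fun k x => ψ k x)
        (c := 1 / n + δ) (by positivity) (fun k x => ?_) (fun k x => by simpa using hψb k x (by simp))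
        hsum hb ((μ.prod (gaussianReal 0 1)).map
          (fun p : ℝ × ℝ => Real.sqrt (2 * p.1) * p.2)) (fun ξ => ?_) y
      · rw [h1.unique h2, hψφ, iteratedDeriv_zero]
      · have h3 := (hφd k x).hasDerivAt
        have h4 : HasDerivAt (fun x : ℝ => (Real.exp (a * x) : ℂ))
            ((Real.exp (a * x) * a : ℝ) : ℂ) x := by
          have h5 : HasDerivAt (fun x : ℝ => Real.exp (a * x)) (Real.exp (a * x) * a) x := by
            simpa using ((hasDerivAt_id x).const_mul a).exp
          exact h5.ofReal_comp
        have h6 := h4.mul h3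
        simp_rw [hψφ]
        refine h6.congr_deriv ?_
        rw [iteratedDeriv_succ]
        push_cast
        ring
      · have h7 := charFun_heatMixture_mul_eq_one hpos hc0 hlap hfl ξ
        convert h7 using 3
        ring
    rw [← hlim]
    refine hval.congr_fun fun k => ?_
    rw [(hint k).2, smul_smul, map_smul]

end

end FourierHyper

end

theorem proposition1p1 {E : Type*} [NormedAddCommGroup E] [NormedSpace ℂ E] [CompleteSpace E]
    (a : ℝ) (ha : 0 ≤ a) (G : FourierHyper.Q a (E →L[ℂ] E)) :
    ∃ (b : ℕ → ℂ) (g : ℝ → (E →L[ℂ] E)),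
      FourierHyper.IsLocalOperator b ∧ Continuous g ∧
      (∀ ε : ℝ, 0 < ε → ∃ C : ℝ, 0 < C ∧
        ∀ x : ℝ, Real.exp (-a * x) * ‖g x‖ ≤ C * Real.exp (ε * |x|)) ∧
      FourierHyper.EqLocalOperatorApply G b g :=
  G.exists_eqLocalOperatorApply
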